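/- Let $k$ be a differential field of characteristic zero with commuting derivations $\delta_1,\dots,\delta_m$, and suppose that $k$ is constructive, that is, there is a surjection $\nu:\mathbb{N}\to k$ such that the relation $\nu(a)=\nu(b)$ on $\mathbb{N}^2$ is decidable and addition, multiplication and every $\delta_i$ are induced by computable functions on $\nu$-numbers. Let $\Theta$ be the set of derivative operators $\theta=\delta_1^{i_1}\cdots\delta_m^{i_m}$, let $k\{x_1,\dots,x_n\}$ be the differential polynomial algebra over $k$ (the polynomial algebra in the independent variables $x_j^\theta$, $\theta\in\Theta$, with $\delta_i(x_j^\theta)=x_j^{\delta_i\theta}$), and let $B=k\langle x_1,\dots,x_n\rangle$ be its field of fractions with the induced derivations. Elements $f_1,\dots,f_r\in B$ are called differentially algebraically dependent if $g(f_1,\dots,f_r)=0$ for some nonzero $g\in k\{y_1,\dots,y_r\}$, where $g(f_1,\dots,f_r)$ is obtained by substituting $f_j^\theta$ for $y_j^\theta$. Then differential algebraic dependence of finite systems in $B$ is algorithmically decidable: for every $n$ there is an algorithm which, given any finite list $f_1,\dots,f_r$ of elements of $B$ (each written as a quotient of two differential polynomials whose coefficients are given by $\nu$-numbers), decides whether $f_1,\dots,f_r$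 are differentially algebraically dependent. -/

import Mathlib

open MvPolynomial

/-- A `Δ`-ring with basic set of derivation operators `Δ = {δ₁, …, δ_m}`: a commutative ring
together with `m` pairwise commuting derivations. -/
class DiffRing (m : ℕ) (R : Type*) [CommRing R] where
  /-- The derivation `δᵢ`, an additive map. -/
  δ : Fin m → R →+ R
  /-- The product rule. -/
  δ_mul : ∀ (i : Fin m) (a b : R), δ i (a * b) = a * δ i b + b * δ i a
  /-- The derivations commute. -/
  δ_comm : ∀ (i j : Fin m) (a : R), δ i (δ j a) = δ j (δ i a)

namespace DiffRing

theorem δ_one {m : ℕ} {R : Type*} [CommRing R] [DiffRing m R] (i : Fin m) :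
    δ i (1 : R) = 0 := by
  simpa using δ_mul i (1 : R) 1

/-- The action `r ↦ r^θ` of the derivative operator `θ = δ₁^{θ₁} ⋯ δ_m^{θ_m}`, encoded by its
exponent vector, on a differential ring. -/
def deriv {m : ℕ} {R : Type*} [CommRing R] [DiffRing m R] (θ : Fin m → ℕ) (r : R) : R :=
  (List.finRange m).foldr (fun i s => (δ i)^[θ i] s) r

/-- The ring homomorphism `r ↦ f(r) + f(δᵢ(r)) ε` to dual numbers, for a ring homomorphism `f`. -/
def toDual {m : ℕ} {R S : Type*} [CommRing R] [CommRing S] [DiffRing m R] (f : R →+* S)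
    (i : Fin m) : R →+* DualNumber S where
  toFun r := TrivSqZeroExt.inl (f r) + TrivSqZeroExt.inr (f (δ i r))
  map_one' := by simp [δ_one]
  map_mul' a b := by
    ext
    · simp
    · simp [δ_mul]; ring
  map_zero' := by simp
  map_add' a b := by ext <;> simp

@[simp]
theorem fst_toDual {m : ℕ} {R S : Type*} [CommRing R] [CommRing S] [DiffRing m R] (f : R →+* S)
    (i : Fin m) (r : R) : (toDual f i r).fst = f r := by simp [toDual]

@[simp]
theorem snd_toDual {m : ℕ} {R S : Type*} [CommRing R] [CommRing S] [DiffRing m R] (f : R →+* S)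
    (i : Fin m) (r : R) : (toDual f i r).snd = f (δ i r) := by simp [toDual]

/-- The `ε`-part of a map to dual numbers, as an additive map. -/
def sndOf {R S : Type*} [CommRing R] [CommRing S] (φ : R →+* DualNumber S) : R →+ S where
  toFun r := (φ r).snd
  map_zero' := by simp
  map_add' := by simp

theorem sndOf_apply {R S : Type*} [CommRing R] [CommRing S] (φ : R →+* DualNumber S) (r : R) :
    sndOf φ r = (φ r).snd := rfl

theorem sndOf_mul {R : Type*} [CommRing R] (φ : R →+* DualNumber R)
    (h : ∀ r, (φ r).fst = r) (a b : R) : sndOf φ (a * b) = a * sndOf φ b + b * sndOf φ a := by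
  simp [sndOf_apply, h, mul_comm b]

end DiffRing

/-! ### Differential polynomials -/

/-- The differential polynomial algebra `k{x₁, …, x_n}` with `m` derivation operators: the
polynomial algebra in the independent variables `x_j^θ`, where `j : Fin n` and `θ` is a derivative
operator. -/
abbrev DiffPoly (m n : ℕ) (k : Type*) [CommRing k] : Type _ :=
  MvPolynomial (Fin n × (Fin m → ℕ)) k

namespace DiffPoly

variable {m n : ℕ} {k : Type*} [CommRing k] [DiffRing m k]

/-- `f ↦ f + δᵢ(f) ε` on `k{x₁, …, x_n}`: on coefficients it is `a ↦ a + δᵢ(a) ε`, and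
`x_j^θ ↦ x_j^θ + x_j^{δᵢ θ} ε`. -/
noncomputable def dualHom (i : Fin m) : DiffPoly m n k →+* DualNumber (DiffPoly m n k) :=
  eval₂Hom (DiffRing.toDual C i)
    (fun v => TrivSqZeroExt.inl (X v) + TrivSqZeroExt.inr (X (v.1, v.2 + Pi.single i 1)))

theorem fst_dualHom (i : Fin m) (f : DiffPoly m n k) : (dualHom i f).fst = f := by
  induction f using MvPolynomial.induction_on with
  | C a => simp [dualHom]
  | add p q hp hq => simp [hp, hq]
  | mul_X p v hp => simp [hp]; simp [dualHom]

/-- The derivation `δᵢ` of `k{x₁, …, x_n}`: it extends `δᵢ` of `k` and sends `x_j^θ` to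
`x_j^{δᵢ θ}`. -/
noncomputable def derivation (i : Fin m) : DiffPoly m n k →+ DiffPoly m n k :=
  DiffRing.sndOf (dualHom i)

@[simp]
theorem derivation_C (i : Fin m) (a : k) :
    derivation i (C a : DiffPoly m n k) = C (DiffRing.δ i a) := by
  simp [derivation, DiffRing.sndOf_apply, dualHom]

@[simp]
theorem derivation_X (i : Fin m) (v : Fin n × (Fin m → ℕ)) :
    derivation i (X v : DiffPoly m n k) = X (v.1, v.2 + Pi.single i 1) := by
  simp [derivation, DiffRing.sndOf_apply, dualHom]

theorem derivation_mul (i : Fin m) (p q : DiffPoly m n k) :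
    derivation i (p * q) = p * derivation i q + q * derivation i p :=
  DiffRing.sndOf_mul (dualHom i) (fst_dualHom i) p q

/-- `k{x₁, …, x_n}` is a differential ring. -/
noncomputable instance : DiffRing m (DiffPoly m n k) where
  δ := derivation
  δ_mul := derivation_mul
  δ_comm i j f := by
    induction f using MvPolynomial.induction_on with
    | C a => simp [DiffRing.δ_comm i j a]
    | add p q hp hq => simp [hp, hq]
    | mul_X p v hp =>
      simp only [derivation_mul, map_add, derivation_X, hp,
        add_right_comm v.2 (Pi.single j 1) (Pi.single i 1)]
      ring

end DiffPoly

/-! ### Differential rational functions -/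

namespace DiffRing

variable {m : ℕ} {R : Type*} [CommRing R] [IsDomain R] [DiffRing m R]

/-- `a / b ↦ (a + δᵢ(a) ε) / (b + δᵢ(b) ε)`, a homomorphism on the field of fractions. -/
noncomputable def fracDualHom (i : Fin m) : FractionRing R →+* DualNumber (FractionRing R) :=
  IsLocalization.lift (M := nonZeroDivisors R)
    (g := toDual (algebraMap R (FractionRing R)) i) (by
      intro y
      rw [TrivSqZeroExt.isUnit_iff_isUnit_fst, fst_toDual]
      exact IsLocalization.map_units (FractionRing R) y)

set_option linter.unusedSectionVars false in
theorem fracDualHom_algebraMap (i : Fin m) (r : R) :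
    fracDualHom i (algebraMap R (FractionRing R) r) =
      toDual (algebraMap R (FractionRing R)) i r :=
  IsLocalization.lift_eq _ r

theorem fst_fracDualHom (i : Fin m) (f : FractionRing R) : (fracDualHom i f).fst = f := by
  obtain ⟨a, b, hb, rfl⟩ := IsFractionRing.div_surjective (A := R) f
  have hb' : algebraMap R (FractionRing R) b ≠ 0 :=
    IsFractionRing.to_map_ne_zero_of_mem_nonZeroDivisors hb
  have h := congrArg TrivSqZeroExt.fst (map_mul (fracDualHom i)
    (algebraMap R (FractionRing R) a / algebraMap R (FractionRing R) b)
    (algebraMap R (FractionRing R) b))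
  rw [div_mul_cancel₀ _ hb', TrivSqZeroExt.fst_mul, fracDualHom_algebraMap,
    fracDualHom_algebraMap, fst_toDual, fst_toDual] at h
  rw [eq_div_iff hb', ← h]

/-- The unique extension of `δᵢ` to the field of fractions. -/
noncomputable def fracDerivation (i : Fin m) : FractionRing R →+ FractionRing R :=
  sndOf (fracDualHom i)

@[simp]
theorem fracDerivation_algebraMap (i : Fin m) (r : R) :
    fracDerivation i (algebraMap R (FractionRing R) r) =
      algebraMap R (FractionRing R) (δ i r) := by
  rw [fracDerivation, sndOf_apply, fracDualHom_algebraMap, snd_toDual]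

theorem fracDerivation_mul (i : Fin m) (f g : FractionRing R) :
    fracDerivation i (f * g) = f * fracDerivation i g + g * fracDerivation i f :=
  sndOf_mul (fracDualHom i) (fst_fracDualHom i) f g

/-- The field of fractions of a differential domain is a differential field. -/
noncomputable instance : DiffRing m (FractionRing R) where
  δ := fracDerivation
  δ_mul := fracDerivation_mul
  δ_comm i j f := by
    obtain ⟨a, b, hb, rfl⟩ := IsFractionRing.div_surjective (A := R) f
    have hb' : algebraMap R (FractionRing R) b ≠ 0 :=
      IsFractionRing.to_map_ne_zero_of_mem_nonZeroDivisors hb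
    have h (i j : Fin m) := congrArg (fun x => fracDerivation i (fracDerivation j x))
      (div_mul_cancel₀ (algebraMap R (FractionRing R) a) hb')
    have h1 := h i j
    have h2 := h j i
    simp only [fracDerivation_mul, map_add, fracDerivation_algebraMap, δ_comm i j b,
      δ_comm i j a] at h1 h2
    refine mul_left_cancel₀ hb' ?_
    linear_combination h1 - h2

end DiffRing

/-- The field `k⟨x₁, …, x_n⟩` of rational differential functions over `k`: the field of fractions
of `k{x₁, …, x_n}`. -/
abbrev DiffRat (m n : ℕ) (k : Type*) [Field k] : Type _ := FractionRing (DiffPoly m n k)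

/-- Elements `f₁, …, f_r` of a differential ring `B` over `k` are differentially algebraically
dependent over `k` if `g(f₁, …, f_r) = 0` for some nonzero differential polynomial
`g ∈ k{y₁, …, y_r}`, where `g(f₁, …, f_r)` is obtained by substituting `f_j^θ` for `y_j^θ`. -/
def DiffAlgDependent (m : ℕ) (k : Type*) {B : Type*} [CommRing k] [CommRing B] [Algebra k B]
    [DiffRing m B] {r : ℕ} (f : Fin r → B) : Prop :=
  ∃ g : DiffPoly m r k, g ≠ 0 ∧
    aeval (fun v : Fin r × (Fin m → ℕ) => DiffRing.deriv v.2 (f v.1)) g = 0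

/-! ### Constructive differential fields -/

/-- The numbering `ν` of the differential field `k` by natural numbers is a constructivization:
every element has a number, equality is decidable on numbers, and addition, multiplication and the
derivations are given by computable functions on numbers. (Numbers of `0`, `1`, negatives and
inverses can then be found by search.) -/
structure IsConstructive (m : ℕ) {k : Type*} [Field k] [DiffRing m k] (ν : ℕ → k) : Prop where
  surjective : Function.Surjective ν
  eq : ComputablePred fun p : ℕ × ℕ => ν p.1 = ν p.2
  add : ∃ s : ℕ → ℕ → ℕ, Computable₂ s ∧ ∀ a b, ν (s a b) = ν a + ν b
  mul : ∃ s : ℕ → ℕ → ℕ, Computable₂ s ∧ ∀ a b, ν (s a b) = ν a * ν b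
  deriv : ∀ i : Fin m, ∃ s : ℕ → ℕ, Computable s ∧ ∀ a, ν (s a) = DiffRing.δ i (ν a)

/-- Written form of a differential polynomial: a finite list of terms, each consisting of the
number of a coefficient and a finite list of variables `x_j^θ`. -/
abbrev PolyCode (m n : ℕ) : Type := List (ℕ × List (Fin n × (Fin m → ℕ)))

/-- The differential polynomial denoted by a code, with coefficients numbered by `ν`. -/
noncomputable def PolyCode.value {m n : ℕ} {k : Type*} [CommRing k] (ν : ℕ → k)
    (c : PolyCode m n) : DiffPoly m n k :=
  (c.map fun t => C (ν t.1) * (t.2.map X).prod).sum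

/-- Written form of a rational differential function: numerator and denominator. -/
abbrev RatCode (m n : ℕ) : Type := PolyCode m n × PolyCode m n

/-- The rational differential function denoted by a code; a code whose denominator denotes the
zero polynomial denotes `0`. -/
noncomputable def RatCode.value {m n : ℕ} {k : Type*} [Field k] (ν : ℕ → k)
    (c : RatCode m n) : DiffRat m n k :=
  algebraMap (DiffPoly m n k) (DiffRat m n k) (PolyCode.value ν c.1) /
    algebraMap (DiffPoly m n k) (DiffRat m n k) (PolyCode.value ν c.2)

/-! Dependence and independence are both recursively enumerable, so dependence is decidable.
Arithmetic, the derivations and the zero test of `B` are computable on codes, hence any proposed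
relation can be verified; what is needed are finite certificates for both answers.

Dependence: call the place `q` of a sequence `e` algebraic if some relation among `e 0, …, e q` has
a separant, with respect to some derivative of the `q`-th variable, that does not vanish at `e`
(`DiffAlgOverPrev`). In characteristic zero a family is dependent exactly when one of its places is
algebraic (`diffAlgDependent_iff`), because no nonzero partial derivative of a nonzero relation of
least degree vanishes at `e`. The certificate is the relation together with the derivative.

Independence: an independent family `f₁, …, f_r` is enlarged by variables as long as it stays
independent. Counting transcendence degrees shows that independent families have at most `n`
members, so this stops after `s` steps with `r + s ≤ n`, and then every `x_j` appended afterwards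
occupies an algebraic place (`exists_completion`). Conversely these `n` algebraic places certify
independence. The sequence of the `f`'s, the `s` chosen variables and `x₁, …, x_n` has `M = r + s +
n ≤ 2n` members, and `add_le_of_diffAlgOverPrev` gives `T + n ≤ M` for any `T` algebraic places in
it; one more algebraic place among the `f`'s would give `2n + 1 ≤ 2n`.

The last inequality is linear algebra over `B`. Differentiating the `T` relations by all `θ ≤ N`
yields `T (N+1)^m` relations whose gradients at `e` are triangular, hence independent. They live in
a space of dimension `M (N+c+1)^m` and are annihilated by the `n (N+c+1)^m` independent functionals
that come from the partial derivations `∂/∂x_j^θ` of `B`. Letting `N` tend to infinity compares the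
leading coefficients. -/

namespace DiffRing

/-! ### Derivative operators and their exponent vectors. -/

variable {m : ℕ}

theorem sub_add_single_one {θ : Fin m → ℕ} {i : Fin m} (hi : θ i ≠ 0) :
    θ - Pi.single i 1 + Pi.single i 1 = θ := by
  ext j
  by_cases hj : j = i
  · subst hj; simp; omega
  · simp [hj]

theorem exponent_induction {P : (Fin m → ℕ) → Prop} (zero : P 0)
    (step : ∀ θ i, P θ → P (θ + Pi.single i 1)) (θ : Fin m → ℕ) : P θ := by
  induction h : ∑ i, θ i generalizing θ with
  | zero =>
    have : θ = 0 := by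
      ext i
      simpa using (Finset.sum_eq_zero_iff.1 h) i (Finset.mem_univ i)
    exact this ▸ zero
  | succ s ih =>
    obtain ⟨i, hi⟩ : ∃ i, θ i ≠ 0 := by
      by_contra! hc
      simp [hc] at h
    have hθ := (sub_add_single_one hi).symm
    rw [hθ]
    refine step _ _ (ih _ ?_)
    rw [hθ] at h
    simp only [Pi.add_apply, Finset.sum_add_distrib, Finset.sum_pi_single', Finset.mem_univ,
      if_true] at h
    simpa using h

variable {R : Type*} [CommRing R] [DiffRing m R]

@[simp]
theorem deriv_zero_exponent (r : R) : deriv (0 : Fin m → ℕ) r = r := by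
  unfold deriv
  induction List.finRange m with
  | nil => rfl
  | cons j l _ => simp

/-- `deriv` applies the `δ j` in a fixed order; commutativity carries the extra `δ i` to the
outside. For induction on the list, indices that do not occur in it must be allowed, and `Nodup`
ensures that `i` is met only once. -/
theorem foldr_iterate_add_single (i : Fin m) (θ : Fin m → ℕ) (r : R) (l : List (Fin m))
    (hl : l.Nodup) :
    l.foldr (fun j s => (δ j)^[(θ + Pi.single i 1 : Fin m → ℕ) j] s) r =
      if i ∈ l then δ i (l.foldr (fun j s => (δ j)^[θ j] s) r)
      else l.foldr (fun j s => (δ j)^[θ j] s) r := by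
  induction l with
  | nil => simp
  | cons j l ih =>
    rw [List.nodup_cons] at hl
    rw [List.foldr_cons, ih hl.2, List.foldr_cons]
    by_cases hj : j = i
    · subst hj
      simp [hl.1, Function.iterate_succ_apply']
    · have hc : Function.Commute (δ j : R → R) (δ i) := fun a => δ_comm j i a
      by_cases hi : i ∈ l
      · simp [hj, hi, (hc.iterate_left (θ j)).eq]
      · simp [hj, hi, Ne.symm hj]

theorem deriv_add_single (i : Fin m) (θ : Fin m → ℕ) (r : R) :
    deriv (θ + Pi.single i 1) r = δ i (deriv θ r) := by
  unfold deriv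
  rw [foldr_iterate_add_single i θ r _ (List.nodup_finRange m)]
  simp

end DiffRing

/-! ### Derivations and partial derivatives of differential polynomials in arbitrary families. -/

open DiffRing

/-- `f ↦ f + δᵢ(f) ε` on the differential polynomials in a family of variables indexed by `ι`. -/
noncomputable def polyDualHom {m : ℕ} {k ι : Type*} [CommRing k] [DiffRing m k] (i : Fin m) :
    MvPolynomial (ι × (Fin m → ℕ)) k →+* DualNumber (MvPolynomial (ι × (Fin m → ℕ)) k) :=
  eval₂Hom (DiffRing.toDual C i)
    (fun v => TrivSqZeroExt.inl (X v) + TrivSqZeroExt.inr (X (v.1, v.2 + Pi.single i 1)))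

section PolyDeriv

variable {m : ℕ} {k ι : Type*} [CommRing k] [DiffRing m k]

theorem fst_polyDualHom (i : Fin m) (f : MvPolynomial (ι × (Fin m → ℕ)) k) :
    (polyDualHom i f).fst = f := by
  induction f using MvPolynomial.induction_on with
  | C a => simp [polyDualHom]
  | add p q hp hq => simp [hp, hq]
  | mul_X p v hp => simp [hp]; simp [polyDualHom]

/-- The derivation `δᵢ` of the differential polynomials in variables indexed by `ι`. -/
noncomputable def polyDeriv (i : Fin m) :
    MvPolynomial (ι × (Fin m → ℕ)) k →+ MvPolynomial (ι × (Fin m → ℕ)) k :=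
  sndOf (polyDualHom i)

@[simp]
theorem polyDeriv_C (i : Fin m) (a : k) :
    polyDeriv i (C a : MvPolynomial (ι × (Fin m → ℕ)) k) = C (δ i a) := by
  simp [polyDeriv, sndOf_apply, polyDualHom]

@[simp]
theorem polyDeriv_X (i : Fin m) (v : ι × (Fin m → ℕ)) :
    polyDeriv i (X v : MvPolynomial (ι × (Fin m → ℕ)) k) = X (v.1, v.2 + Pi.single i 1) := by
  simp [polyDeriv, sndOf_apply, polyDualHom]

theorem polyDeriv_mul (i : Fin m) (p q : MvPolynomial (ι × (Fin m → ℕ)) k) :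
    polyDeriv i (p * q) = p * polyDeriv i q + q * polyDeriv i p :=
  sndOf_mul (polyDualHom i) (fst_polyDualHom i) p q

theorem polyDeriv_mem_supported {S T : Set (ι × (Fin m → ℕ))} (i : Fin m) (hST : S ⊆ T)
    (h : ∀ v ∈ S, (v.1, v.2 + Pi.single i 1) ∈ T) {p : MvPolynomial (ι × (Fin m → ℕ)) k}
    (hp : p ∈ supported k S) : polyDeriv i p ∈ supported k T := by
  have hle := supported_mono (R := k) hST
  induction hp using Algebra.adjoin_induction with
  | mem x hx =>
    obtain ⟨v, hv, rfl⟩ := hx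
    rw [polyDeriv_X]
    exact Algebra.subset_adjoin ⟨_, h v hv, rfl⟩
  | algebraMap r =>
    rw [algebraMap_eq, polyDeriv_C]
    exact (supported k T).algebraMap_mem _
  | add x y _ _ hx hy => rw [map_add]; exact add_mem hx hy
  | mul x y hx' hy' hx hy =>
    rw [polyDeriv_mul]
    exact add_mem (mul_mem (hle hx') hy) (mul_mem (hle hy') hx)

/-- The commutator of `∂/∂y^{δᵢθ}` and `δᵢ` is `∂/∂y^θ`: `δᵢ` moves the variable `y^θ` to `y^{δᵢθ}`.
By the product rule it suffices to look at constants and variables. -/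
theorem pderiv_polyDeriv_add_single (i : Fin m) (q : ι) (θ : Fin m → ℕ)
    (p : MvPolynomial (ι × (Fin m → ℕ)) k) :
    pderiv (q, θ + Pi.single i 1) (polyDeriv i p) =
      polyDeriv i (pderiv (q, θ + Pi.single i 1) p) + pderiv (q, θ) p := by
  classical
  have hone : polyDeriv i (1 : MvPolynomial (ι × (Fin m → ℕ)) k) =
        0 := by
    rw [← C_1, polyDeriv_C, δ_one, C_0]
  induction p using MvPolynomial.induction_on with
  | C a => simp
  | add p q hp hq => simp only [map_add, hp, hq]; ring
  | mul_X p v hp =>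
    have hv : pderiv (q, θ + Pi.single i 1) (X (v.1, v.2 + Pi.single i 1)) =
        pderiv (q, θ) (X v : MvPolynomial (ι × (Fin m → ℕ)) k) := by
      simp [pderiv_X, Pi.single_apply, Prod.ext_iff]
    have hv' : polyDeriv i (pderiv (q, θ + Pi.single i 1)
        (X v : MvPolynomial (ι × (Fin m → ℕ)) k)) = 0 := by
      rw [pderiv_X, Pi.single_apply]; split_ifs <;> simp [hone]
    simp only [polyDeriv_mul, pderiv_mul, map_add, polyDeriv_X, hp, hv, hv']
    ring

/-- The complementary case: when `θ i = 0`, no variable is moved to `y^θ` by `δᵢ`, so the commutator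
vanishes. -/
theorem pderiv_polyDeriv_of_eq_zero (i : Fin m) (q : ι) (θ : Fin m → ℕ) (hθ : θ i = 0)
    (p : MvPolynomial (ι × (Fin m → ℕ)) k) :
    pderiv (q, θ) (polyDeriv i p) = polyDeriv i (pderiv (q, θ) p) := by
  classical
  have hone : polyDeriv i (1 : MvPolynomial (ι × (Fin m → ℕ)) k) =
        0 := by
    rw [← C_1, polyDeriv_C, δ_one, C_0]
  induction p using MvPolynomial.induction_on with
  | C a => simp
  | add p q hp hq => simp only [map_add, hp, hq]
  | mul_X p v hp =>
    have hv : pderiv (q, θ) (X (v.1, v.2 + Pi.single i 1) : MvPolynomial (ι × (Fin m → ℕ)) k) =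
        0 := by
      apply pderiv_X_of_ne
      intro h
      have := congrFun (Prod.ext_iff.1 h).2 i
      simp [hθ] at this
    have hv' : polyDeriv i (pderiv (q, θ) (X v : MvPolynomial (ι × (Fin m → ℕ)) k)) = 0 := by
      rw [pderiv_X, Pi.single_apply]; split_ifs <;> simp [hone]
    simp only [polyDeriv_mul, pderiv_mul, map_add, polyDeriv_X, hp, hv, hv']
    ring

end PolyDeriv

/-! ### Partial derivatives over a field. -/

section PDeriv

variable {σ k : Type*} [Field k]

/-- A coefficient of `p` gets multiplied by a positive exponent, which is nonzero in `k`. The whole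
argument uses characteristic zero through this fact. -/
theorem pderiv_ne_zero_of_mem_vars [CharZero k] {p : MvPolynomial σ k} {v : σ} (hv : v ∈ p.vars) :
    pderiv v p ≠ 0 := by
  classical
  obtain ⟨d, hd, hvd⟩ := mem_vars_iff_mem_support v |>.1 hv
  intro h
  have hc := coeff_pderiv (i := v) p (d - Finsupp.single v 1)
  have hdv : d - Finsupp.single v 1 + Finsupp.single v 1 = d := by
    apply tsub_add_cancel_of_le
    rw [Finsupp.single_le_iff]
    exact Nat.one_le_iff_ne_zero.2 (Finsupp.mem_support_iff.1 hvd)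
  rw [h, hdv, coeff_zero] at hc
  have h1 : coeff d p ≠ 0 := mem_support_iff.1 hd
  have h2 : (((d - Finsupp.single v 1 : σ →₀ ℕ) v : ℕ) : k) + 1 ≠ 0 := Nat.cast_add_one_ne_zero _
  have h3 := mul_ne_zero h1 h2
  apply h3
  exact hc.symm

theorem totalDegree_pderiv_lt {p : MvPolynomial σ k} {v : σ} (h : pderiv v p ≠ 0) :
    (pderiv v p).totalDegree < p.totalDegree := by
  classical
  obtain ⟨d, hd, hdeg⟩ := Finset.exists_mem_eq_sup _ (support_nonempty.2 h)
    fun s : σ →₀ ℕ => s.sum fun _ e => e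
  have hc : coeff (d + Finsupp.single v 1) p ≠ 0 := by
    intro h0
    have := coeff_pderiv (i := v) p d
    rw [h0] at this
    exact mem_support_iff.1 hd (by simpa using this)
  have := le_totalDegree (mem_support_iff.2 hc)
  rw [Finsupp.sum_add_index' (by simp) (by simp), Finsupp.sum_single_index rfl] at this
  rw [totalDegree, hdeg]
  omega

theorem vars_pderiv_subset (p : MvPolynomial σ k) (v : σ) : (pderiv v p).vars ⊆ p.vars := by
  classical
  intro w hw
  obtain ⟨d, hd, hwd⟩ := mem_vars_iff_mem_support w |>.1 hw
  refine mem_vars_iff_mem_support w |>.2 ⟨d + Finsupp.single v 1, ?_, ?_⟩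
  · rw [mem_support_iff]
    intro h0
    have := coeff_pderiv (i := v) p d
    rw [h0] at this
    exact mem_support_iff.1 hd (by simpa using this)
  · rw [Finsupp.mem_support_iff] at *
    simp [hwd]

end PDeriv

/-! ### Relations, their gradients and their prolongations. -/

/-- Evaluation of differential polynomials in variables indexed by `ι` at a family of elements of a
differential algebra. -/
noncomputable def diffEval {m : ℕ} (k : Type*) {B ι : Type*} [CommRing k] [CommRing B] [Algebra k B]
    [DiffRing m B] (e : ι → B) : MvPolynomial (ι × (Fin m → ℕ)) k →ₐ[k] B :=
  aeval fun v => deriv v.2 (e v.1)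

/-- The structure map of a differential algebra commutes with the derivations. -/
class IsDiffAlgebra (m : ℕ) (k B : Type*) [CommRing k] [CommRing B] [Algebra k B]
    [DiffRing m k] [DiffRing m B] : Prop where
  δ_algebraMap : ∀ (i : Fin m) (a : k), δ i (algebraMap k B a) = algebraMap k B (δ i a)

/-- The element `e q` is differentially algebraic over the differential field generated by
the `e j` with `j < q`: there is a relation whose separant with respect to a derivative of the
`q`-th variable does not vanish. -/
def DiffAlgOverPrev {m : ℕ} (k : Type*) {B : Type*} [CommRing k] [CommRing B] [Algebra k B]
    [DiffRing m B] (e : ℕ → B) (q : ℕ) : Prop :=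
  ∃ g ∈ supported k {v : ℕ × (Fin m → ℕ) | v.1 ≤ q}, diffEval k e g = 0 ∧
    ∃ θ, diffEval k e (pderiv (q, θ) g) ≠ 0

section

variable {m : ℕ} {k B ι : Type*} [CommRing k] [CommRing B] [Algebra k B] [DiffRing m k]
  [DiffRing m B]

omit [DiffRing m k] in
@[simp]
theorem diffEval_X (e : ι → B) (v : ι × (Fin m → ℕ)) :
    diffEval k e (X v) = deriv v.2 (e v.1) := by
  simp [diffEval]

theorem diffEval_polyDeriv [IsDiffAlgebra m k B] (e : ι → B) (i : Fin m)
    (p : MvPolynomial (ι × (Fin m → ℕ)) k) :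
    diffEval k e (polyDeriv i p) = δ i (diffEval k e p) := by
  induction p using MvPolynomial.induction_on with
  | C a => simp [diffEval, IsDiffAlgebra.δ_algebraMap]
  | add p q hp hq => simp [hp, hq]
  | mul_X p v hp => simp [polyDeriv_mul, hp, δ_mul, deriv_add_single]

omit [DiffRing m k] in
-- Here `D` is a further derivation of `B`, trivial on `k` and unrelated to the `δ i`. If `p`
-- vanishes at `e`, the left side is zero, so the gradient of `p` at `e` is orthogonal to the vector
-- of values of `D`.
theorem diffEval_chain_rule (e : ι → B) (D : B →+ B) (hmul : ∀ a b, D (a * b) = a * D b + b * D a)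
    (hk : ∀ a, D (algebraMap k B a) = 0) (S : Finset (ι × (Fin m → ℕ)))
    {p : MvPolynomial (ι × (Fin m → ℕ)) k} (hp : p ∈ supported k (S : Set (ι × (Fin m → ℕ)))) :
    D (diffEval k e p) = ∑ v ∈ S, diffEval k e (pderiv v p) * D (deriv v.2 (e v.1)) := by
  classical
  induction hp using Algebra.adjoin_induction with
  | mem x hx =>
    obtain ⟨v, hv, rfl⟩ := hx
    rw [Finset.sum_eq_single v]
    · simp
    · intro b _ hb
      simp [pderiv_X_of_ne hb.symm]
    · intro h
      exact absurd hv h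
  | algebraMap r => simp [hk]
  | add x y _ _ hx hy => simp only [map_add, hx, hy, add_mul, Finset.sum_add_distrib]
  | mul x y _ _ hx hy =>
    simp only [map_mul, hmul, hx, hy, pderiv_mul, map_add, Finset.mul_sum, ← Finset.sum_add_distrib]
    refine Finset.sum_congr rfl fun v _ => ?_
    ring

/-- Differentiating a relation shifts the leading derivative of its gradient. -/
theorem exists_prolongation [IsDiffAlgebra m k B] (e : ℕ → B) {q : ℕ} {v c : Fin m → ℕ}
    {g : MvPolynomial (ℕ × (Fin m → ℕ)) k}
    (hg : diffEval k e g = 0) (hlead : diffEval k e (pderiv (q, v) g) ≠ 0)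
    (hmax : ∀ u, toLex v < toLex u → diffEval k e (pderiv (q, u) g) = 0)
    (hsupp : g ∈ supported k {w : ℕ × (Fin m → ℕ) | w.1 ≤ q ∧ w.2 ≤ c}) (θ : Fin m → ℕ) :
    ∃ h : MvPolynomial (ℕ × (Fin m → ℕ)) k, diffEval k e h = 0 ∧
      diffEval k e (pderiv (q, v + θ) h) ≠ 0 ∧
      (∀ u, toLex (v + θ) < toLex u → diffEval k e (pderiv (q, u) h) = 0) ∧
      h ∈ supported k {w : ℕ × (Fin m → ℕ) | w.1 ≤ q ∧ w.2 ≤ c + θ} := by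
  induction θ using exponent_induction with
  | zero => exact ⟨g, by simpa using ⟨hg, hlead, hmax, hsupp⟩⟩
  | step θ i ih =>
    obtain ⟨h, h1, h2, h3, h4⟩ := ih
    have hlt : toLex (v + θ) < toLex (v + θ + Pi.single i 1) := by
      rw [toLex_add]
      apply lt_add_of_pos_right
      have hpos : (0 : Fin m → ℕ) < Pi.single i 1 := Pi.single_pos.2 Nat.one_pos
      exact Pi.toLex_strictMono hpos
    refine ⟨polyDeriv i h, ?_, ?_, ?_, ?_⟩
    · rw [diffEval_polyDeriv, h1, map_zero]
    -- Of the two terms in the commutator formula, one is `δ i` of a separant beyond the leading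
    -- exponent, hence of zero; the other is the old leading separant.
    · rw [← add_assoc, pderiv_polyDeriv_add_single, map_add, diffEval_polyDeriv,
        h3 _ hlt, map_zero, zero_add]
      exact h2
    · intro u hu
      rw [← add_assoc] at hu
      by_cases hui : u i = 0
      · rw [pderiv_polyDeriv_of_eq_zero i q u hui, diffEval_polyDeriv, h3 u (hlt.trans hu),
          map_zero]
      · obtain ⟨u', rfl⟩ : ∃ u' : Fin m → ℕ, u = u' + Pi.single i 1 :=
          ⟨_, (sub_add_single_one hui).symm⟩
        rw [pderiv_polyDeriv_add_single, map_add, diffEval_polyDeriv, h3 _ (hlt.trans hu), map_zero,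
          zero_add]
        apply h3
        rw [toLex_add, toLex_add] at hu
        exact lt_of_add_lt_add_right hu
    · refine polyDeriv_mem_supported i ?_ ?_ h4
      · rintro w ⟨hw1, hw2⟩
        exact ⟨hw1, hw2.trans (by rw [← add_assoc]; exact le_self_add)⟩
      · rintro w ⟨hw1, hw2⟩
        exact ⟨hw1, by rw [← add_assoc]; exact add_le_add_left hw2 _⟩

end

/-! ### Rank estimates and the bound on the number of algebraic places. -/

section LinearAlgebra

/-- In a linear relation, the row with the largest key is the only one with a nonzero entry at its
own pivot. -/
theorem linearIndependent_of_triangular {P S K : Type*} {κ : Type*} [LinearOrder κ] [Field K]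
    (ψ : P → S → K) (key : P → κ) (hkey : Function.Injective key) (piv : P → S)
    (hne : ∀ a, ψ a (piv a) ≠ 0) (hlt : ∀ a b, key b < key a → ψ b (piv a) = 0) :
    LinearIndependent K ψ := by
  classical
  rw [linearIndependent_iff]
  intro l hl
  by_contra h0
  obtain ⟨a, ha, hmax⟩ := l.support.exists_max_image key (Finsupp.support_nonempty_iff.2 h0)
  have := congrFun hl (piv a)
  rw [Finsupp.linearCombination_apply, Finsupp.sum, Finset.sum_apply,
    Finset.sum_eq_single_of_mem a ha] at this
  · simp only [Pi.smul_apply, smul_eq_mul, Pi.zero_apply, mul_eq_zero, hne a, or_false] at this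
    exact Finsupp.mem_support_iff.1 ha this
  · intro b hb hba
    have : key b < key a := lt_of_le_of_ne (hmax b hb) fun h => hba (hkey h)
    simp [hlt a b this]

theorem card_add_finrank_le {P K V W : Type*} [Fintype P] [Field K] [AddCommGroup V] [Module K V]
    [FiniteDimensional K V] [AddCommGroup W] [Module K W] (Φ : V →ₗ[K] W)
    (hΦ : Function.Surjective Φ) (ψ : P → V) (hψ : LinearIndependent K ψ) (h : ∀ a, Φ (ψ a) = 0) :
    Fintype.card P + Module.finrank K W ≤ Module.finrank K V := by
  have h1 := Φ.finrank_range_add_finrank_ker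
  rw [LinearMap.range_eq_top.2 hΦ, finrank_top] at h1
  have h2 : LinearIndependent K (fun a => (⟨ψ a, h a⟩ : LinearMap.ker Φ)) :=
    LinearIndependent.of_comp (LinearMap.ker Φ).subtype hψ
  have := h2.fintype_card_le_finrank
  omega

/-- Both sides are polynomials in `N` of degree `m` up to the factors `a` and `b`, and the shift by
`c` does not affect the leading coefficient. Divide by `(N + 1) ^ m` and let `N` tend to infinity.
-/
theorem le_of_forall_mul_pow_le {a b c m : ℕ}
    (h : ∀ N, a * (N + 1) ^ m ≤ b * (N + c + 1) ^ m) : a ≤ b := by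
  have hlim : Filter.Tendsto (fun N : ℕ => (b : ℝ) * (1 + (c : ℝ) * (1 / ((N : ℝ) + 1))) ^ m)
      Filter.atTop (nhds ((b : ℝ) * (1 + c * 0) ^ m)) :=
    ((((tendsto_one_div_add_atTop_nhds_zero_nat (𝕜 := ℝ)).const_mul _).const_add _).pow
      m).const_mul _
  simp only [mul_zero, add_zero, one_pow, mul_one] at hlim
  have hle : (a : ℝ) ≤ b := by
    refine ge_of_tendsto' hlim fun N => ?_
    have hN : (0 : ℝ) < (N : ℝ) + 1 := by positivity
    have h1 : (a : ℝ) * ((N : ℝ) + 1) ^ m ≤ b * ((N : ℝ) + c + 1) ^ m := by exact_mod_cast h N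
    have h2 : (1 + (c : ℝ) * (1 / ((N : ℝ) + 1))) = ((N : ℝ) + c + 1) / ((N : ℝ) + 1) := by
      field_simp; ring
    rw [h2, div_pow, mul_div_assoc', le_div_iff₀ (by positivity)]
    exact h1
  exact_mod_cast hle

theorem card_Iic_const (m N : ℕ) :
    (Finset.Iic (fun _ => N : Fin m → ℕ)).card = (N + 1) ^ m := by
  simp [Pi.card_Iic]

end LinearAlgebra

/-- A strictly increasing sequence of `T` differentially algebraic places among `M` elements that
generate `n` differentially independent ones leaves `n` places. -/
theorem add_le_of_diffAlgOverPrev {m : ℕ} {k B : Type*} [CommRing k] [Field B] [Algebra k B]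
    [DiffRing m k] [DiffRing m B] [IsDiffAlgebra m k B] (e : ℕ → B) {n M T : ℕ}
    (D : Fin n × (Fin m → ℕ) → B →+ B) (hmul : ∀ w a b, D w (a * b) = a * D w b + b * D w a)
    (hk : ∀ w a, D w (algebraMap k B a) = 0) (x : Fin n → ℕ) (hxM : ∀ j, x j < M)
    (hx : ∀ w j θ, D w (deriv θ (e (x j))) = if w = (j, θ) then 1 else 0)
    (piv : Fin T → ℕ) (hpiv : StrictMono piv) (hM : ∀ t, piv t < M)
    (hT : ∀ t, DiffAlgOverPrev (m := m) k e (piv t)) : T + n ≤ M := by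
  classical
  have key : ∀ t, ∃ (g : MvPolynomial (ℕ × (Fin m → ℕ)) k) (v : Fin m → ℕ) (c : ℕ),
      diffEval k e g = 0 ∧ diffEval k e (pderiv (piv t, v) g) ≠ 0 ∧
      (∀ u, toLex v < toLex u → diffEval k e (pderiv (piv t, u) g) = 0) ∧
      g ∈ supported k {w : ℕ × (Fin m → ℕ) | w.1 ≤ piv t ∧ w.2 ≤ fun _ => c} ∧ v ≤ fun _ => c := by
    intro t
    obtain ⟨g, hg, hg0, θ, hθ⟩ := hT t
    rw [mem_supported] at hg
    have hmemv : ∀ u, diffEval k e (pderiv (piv t, u) g) ≠ 0 → (piv t, u) ∈ g.vars := by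
      intro u hu
      by_contra hc
      exact hu (by rw [pderiv_eq_zero_of_notMem_vars hc, map_zero])
    -- The leading exponent is the lexicographically largest one whose separant is nonzero at `e`,
    -- not the largest one occurring in `g`.
    obtain ⟨w, hw, hmax⟩ := ({w ∈ g.vars | w.1 = piv t ∧
      diffEval k e (pderiv (piv t, w.2) g) ≠ 0} : Finset _).exists_max_image (fun w => toLex w.2)
      ⟨(piv t, θ), by simp [hmemv θ hθ, hθ]⟩
    simp only [Finset.mem_filter] at hw hmax
    have hbd : ∀ w ∈ g.vars, w.2 ≤ fun _ => g.vars.sup fun w => Finset.univ.sup w.2 :=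
      fun w hw i => (Finset.le_sup (f := w.2) (Finset.mem_univ i)).trans
        (Finset.le_sup (f := fun w : ℕ × (Fin m → ℕ) => Finset.univ.sup w.2) hw)
    refine ⟨g, w.2, g.vars.sup fun w => Finset.univ.sup w.2, hg0, hw.2.2, ?_, ?_, hbd w hw.1⟩
    · intro u hu
      by_contra hc
      exact absurd (hmax (piv t, u) ⟨hmemv u hc, rfl, hc⟩) (not_le.2 hu)
    · rw [mem_supported]
      intro w hw
      exact ⟨hg hw, hbd w hw⟩
  choose g v c hg hlead hmax hsupp hvc using key
  -- A common bound for the exponents of all `T` relations: their derivatives by `θ ≤ N` involve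
  -- only exponents up to `N + c₀`.
  set c₀ := Finset.univ.sup c
  choose h h0 h1 h2 h3 using fun t =>
    exists_prolongation e (hg t) (hlead t) (hmax t) (hsupp t)
  refine le_of_forall_mul_pow_le (m := m) (c := c₀) fun N => ?_
  let S : Finset (ℕ × (Fin m → ℕ)) := Finset.range M ×ˢ Finset.Iic (fun _ => N + c₀)
  let P := Fin T × Finset.Iic (fun _ => N : Fin m → ℕ)
  let Q := Fin n × Finset.Iic (fun _ => N + c₀ : Fin m → ℕ)
  have hcN : ∀ (t : Fin T) (θ : Finset.Iic (fun _ => N : Fin m → ℕ)) (u : Fin m → ℕ),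
      (u ≤ fun _ => c t) → u + θ.1 ≤ fun _ => N + c₀ := by
    intro t θ u hu i
    have h1 := hu i
    have h2 := Finset.mem_Iic.1 θ.2 i
    have h3 : c t ≤ c₀ := Finset.le_sup (Finset.mem_univ t)
    simp only [Pi.add_apply] at *
    omega
  have hS : ∀ a : P, h a.1 a.2.1 ∈ supported k (S : Set (ℕ × (Fin m → ℕ))) := by
    intro a
    refine supported_mono ?_ (h3 a.1 a.2.1)
    rintro w ⟨hw1, hw2⟩
    simp only [S, Finset.coe_product, Set.mem_prod, Finset.mem_coe, Finset.mem_range,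
      Finset.mem_Iic]
    exact ⟨hw1.trans_lt (hM _), hw2.trans (hcN a.1 a.2 _ le_rfl)⟩
  let ψ : P → S → B := fun a w => diffEval k e (pderiv w.1 (h a.1 a.2.1))
  -- The coordinate `w` of `Φ a` pairs `a` with the values of `D w` on the derivatives of the `e i`;
  -- the chain rule puts all gradients into the kernel.
  let Φ : (S → B) →ₗ[B] (Q → B) :=
    { toFun a w := ∑ u : S, a u * D (w.1, w.2.1) (deriv u.1.2 (e u.1.1))
      map_add' a b := by
        ext w
        simp [add_mul, Finset.sum_add_distrib]
      map_smul' r a := by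
        ext w
        simp [Finset.mul_sum, mul_assoc] }
  have hΦψ : ∀ a, Φ (ψ a) = 0 := by
    intro a
    ext w
    have := diffEval_chain_rule e (D (w.1, w.2.1)) (hmul _) (hk _) S (hS a)
    rw [h0, map_zero, ← Finset.sum_coe_sort] at this
    exact this.symm
  have hΦ : Function.Surjective Φ := by
    intro b
    -- By `hx` the coordinates belonging to the variables are dual to the `D w`, so `Φ` maps these
    -- unit vectors to the unit vectors of the target.
    let inj : Q → S := fun w => ⟨(x w.1, w.2.1), by
      simp only [S, Finset.mem_product, Finset.mem_range]
      exact ⟨hxM _, w.2.2⟩⟩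
    refine ⟨∑ w : Q, b w • Pi.single (inj w) 1, ?_⟩
    rw [map_sum]
    ext w
    have hs : ∀ w' : Q, Φ (Pi.single (inj w') 1) = Pi.single w' 1 := by
      intro w'
      ext w
      have : Φ (Pi.single (inj w') 1) w =
          D (w.1, w.2.1) (deriv (inj w').1.2 (e (inj w').1.1)) := by
        simp [Φ, Pi.single_apply]
      rw [this, hx, Pi.single_apply]
      refine if_congr ⟨fun h => ?_, fun h => h ▸ rfl⟩ rfl rfl
      exact Prod.ext (Prod.ext_iff.1 h).1 (Subtype.ext (Prod.ext_iff.1 h).2)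
    simp only [map_smul, hs]
    rw [Finset.sum_apply, Finset.sum_eq_single w]
    · simp
    · intro w' _ hw'
      simp [hw'.symm]
    · simp
  have hψ : LinearIndependent B ψ := by
    -- Rows are ordered by place, then lexicographically by `θ`. A relation at an earlier place does
    -- not involve the pivot variable of a later place; at equal places a smaller `θ` has a smaller
    -- leading exponent.
    refine linearIndependent_of_triangular ψ (fun a => toLex (a.1, toLex a.2.1)) ?_
      (fun a => ⟨(piv a.1, v a.1 + a.2.1), ?_⟩) (fun a => h1 a.1 a.2.1) ?_
    · intro a b hab
      have := Prod.ext_iff.1 (toLex.injective hab)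
      exact Prod.ext this.1 (Subtype.ext (toLex.injective this.2))
    · exact Finset.mem_product.2
        ⟨Finset.mem_range.2 (hM _), Finset.mem_Iic.2 (hcN a.1 a.2 _ (hvc _))⟩
    · intro a b hab
      rcases Prod.Lex.toLex_lt_toLex.1 hab with hlt | ⟨heq, hlt⟩
      · have : (piv a.1, v a.1 + a.2.1) ∉ (h b.1 b.2.1).vars := by
          intro hmem
          have h4 := h3 b.1 b.2.1
          rw [mem_supported] at h4
          exact absurd (h4 hmem).1 (not_le.2 (hpiv hlt))
        simp only [ψ]
        rw [pderiv_eq_zero_of_notMem_vars this, map_zero]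
      · obtain ⟨t, θ⟩ := a
        obtain ⟨t', θ'⟩ := b
        obtain rfl : t' = t := heq
        apply h2
        rw [toLex_add, toLex_add]
        exact add_lt_add_right hlt _
  have := card_add_finrank_le Φ hΦ ψ hψ hΦψ
  simp only [Module.finrank_fintype_fun_eq_card, P, Q, S, Fintype.card_prod, Fintype.card_fin,
    Fintype.card_coe, Finset.card_product, Finset.card_range, card_Iic_const] at this
  -- The term `n (N + c₀ + 1)^m` may be lowered to `n (N + 1)^m`, so that `T + n` appears as a
  -- common factor.
  refine le_trans ?_ this
  rw [add_mul]
  gcongr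
  omega

/-! ### Dependence expressed through algebraic places. -/

section

variable {m : ℕ} {k B : Type*} [CommRing B] [DiffRing m B]

theorem diffEval_rename_of_mem_supported [CommRing k] [Algebra k B] {e e' : ℕ → B} {q : ℕ}
    (σ : ℕ → ℕ) (he : ∀ j ≤ q, e' (σ j) = e j) {p : MvPolynomial (ℕ × (Fin m → ℕ)) k}
    (hp : p ∈ supported k {v : ℕ × (Fin m → ℕ) | v.1 ≤ q}) :
    diffEval k e' (rename (Prod.map σ id) p) = diffEval k e p := by
  induction hp using Algebra.adjoin_induction with
  | mem x hx =>
    obtain ⟨v, hv, rfl⟩ := hx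
    simp [he v.1 hv]
  | algebraMap r => simp
  | add x y _ _ hx hy => simp only [map_add, hx, hy]
  | mul x y _ _ hx hy => simp only [map_mul, hx, hy]

theorem pderiv_mem_supported [Field k] {S : Set (ℕ × (Fin m → ℕ))}
    {p : MvPolynomial (ℕ × (Fin m → ℕ)) k} (hp : p ∈ supported k S) (v : ℕ × (Fin m → ℕ)) :
    pderiv v p ∈ supported k S := by
  rw [mem_supported] at *
  exact subset_trans (Finset.coe_subset.2 (vars_pderiv_subset p v)) hp

variable [Field k] [Algebra k B]

/-- Being algebraic survives when further elements are inserted before the `q`-th one. Renaming by a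
transposition, rather than by a map defined only up to `q`, is injective and so commutes with
partial derivatives. -/
theorem DiffAlgOverPrev.of_swap {e e' : ℕ → B} {q q' : ℕ} (hq : q ≤ q')
    (he : ∀ j < q, e' j = e j) (heq : e' q' = e q) (h : DiffAlgOverPrev (m := m) k e q) :
    DiffAlgOverPrev (m := m) k e' q' := by
  obtain ⟨g, hg, hg0, θ, hθ⟩ := h
  have hσ : ∀ j ≤ q, e' (Equiv.swap q q' j) = e j := by
    intro j hj
    rcases hj.eq_or_lt with rfl | hj
    · rw [Equiv.swap_apply_left, heq]
    · rw [Equiv.swap_apply_of_ne_of_ne hj.ne (hj.trans_le hq).ne, he j hj]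
  have hinj : Function.Injective (Prod.map (Equiv.swap q q') (id : (Fin m → ℕ) → Fin m → ℕ)) :=
    (Equiv.swap q q').injective.prodMap Function.injective_id
  refine ⟨rename (Prod.map (Equiv.swap q q') id) g, ?_, ?_, θ, ?_⟩
  · classical
    rw [mem_supported] at *
    intro v hv
    have hv' := vars_rename _ _ hv
    rw [Finset.mem_image] at hv'
    obtain ⟨w, hw, rfl⟩ := hv'
    have hwq : w.1 ≤ q := hg hw
    simp only [Set.mem_ofPred_eq, Prod.map_fst]
    rcases hwq.eq_or_lt with h | h
    · rw [h, Equiv.swap_apply_left]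
    · rw [Equiv.swap_apply_of_ne_of_ne h.ne (h.trans_le hq).ne]
      exact hwq.trans hq
  · rw [diffEval_rename_of_mem_supported _ hσ hg, hg0]
  · have : (q', θ) = Prod.map (Equiv.swap q q') id (q, θ) := by simp
    rw [this, pderiv_rename hinj, diffEval_rename_of_mem_supported _ hσ (pderiv_mem_supported hg _)]
    exact hθ

/-- Take a nonzero relation of least total degree and the last place occurring in it: the separant
there is nonzero of smaller degree, so it cannot vanish at `e`. Conversely, a relation with a
nonvanishing separant is nonzero. -/
theorem diffAlgDependent_iff [CharZero k] [Nontrivial B] {r : ℕ} (f : Fin r → B) (e : ℕ → B)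
    (he : ∀ i : Fin r, e i = f i) :
    DiffAlgDependent m k f ↔ ∃ q < r, DiffAlgOverPrev (m := m) k e q := by
  have hinj : Function.Injective (Prod.map (Fin.val : Fin r → ℕ) (id : (Fin m → ℕ) → Fin m → ℕ)) :=
    Fin.val_injective.prodMap Function.injective_id
  have hev : ∀ g : DiffPoly m r k, diffEval k e (rename (Prod.map Fin.val id) g) =
      aeval (fun v : Fin r × (Fin m → ℕ) => DiffRing.deriv v.2 (f v.1)) g := by
    intro g
    rw [diffEval, aeval_rename]
    congr 2
    ext v
    simp [he]
  constructor
  · rintro ⟨g, hg, hg0⟩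
    let P : ℕ → Prop := fun d => ∃ h : MvPolynomial (ℕ × (Fin m → ℕ)) k, h.totalDegree = d ∧
      h ≠ 0 ∧ (∀ v ∈ h.vars, v.1 < r) ∧ diffEval k e h = 0
    have hP : ∃ d, P d := by
      classical
      refine ⟨_, rename (Prod.map Fin.val id) g, rfl, ?_, ?_, ?_⟩
      · rwa [Ne, map_eq_zero_iff _ (rename_injective _ hinj)]
      · intro v hv
        obtain ⟨w, -, rfl⟩ := Finset.mem_image.1 (vars_rename _ _ hv)
        exact w.1.2
      · rw [hev, hg0]
    classical
    obtain ⟨h, hd, hne, hvars, h0⟩ := Nat.find_spec hP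
    have hmin : ∀ v, pderiv v h ≠ 0 → diffEval k e (pderiv v h) ≠ 0 := by
      intro v hv hv0
      refine Nat.find_min hP (hd ▸ totalDegree_pderiv_lt hv) ⟨_, rfl, hv, ?_, hv0⟩
      exact fun w hw => hvars w (vars_pderiv_subset h v hw)
    -- A relation without variables is a constant that is zero in `B`, hence zero in `k`.
    have hvne : h.vars.Nonempty := by
      by_contra hc
      rw [Finset.not_nonempty_iff_eq_empty] at hc
      obtain ⟨a, rfl⟩ : ∃ a, h = C a := ⟨_, (vars_eq_empty_iff_eq_C.1 hc)⟩
      have ha : algebraMap k B a = 0 := by simpa [diffEval] using h0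
      rw [map_eq_zero_iff _ (algebraMap k B).injective] at ha
      exact hne (by rw [ha, C_0])
    obtain ⟨w, hw, hmax⟩ := h.vars.exists_max_image Prod.fst hvne
    refine ⟨w.1, hvars w hw, h, ?_, h0, w.2, hmin w (pderiv_ne_zero_of_mem_vars hw)⟩
    rw [mem_supported]
    exact fun v hv => hmax v hv
  · rintro ⟨q, hq, g, hg, hg0, θ, hθ⟩
    rw [mem_supported] at hg
    obtain ⟨g', rfl⟩ := exists_rename_eq_of_vars_subset_range g
      (Prod.map (Fin.val : Fin r → ℕ) (id : (Fin m → ℕ) → Fin m → ℕ)) hinj (by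
        intro v hv
        exact ⟨(⟨v.1, (hg hv).trans_lt hq⟩, v.2), rfl⟩)
    refine ⟨g', ?_, by rw [← hev, hg0]⟩
    rintro rfl
    simp at hθ

end

/-! ### Independent families of rational differential functions have at most `n` members. -/

/-- Rank comparison in the matroid of algebraic independence: the `z i` lie in the closure of `S`,
whose rank is at most the size of `S`. -/
theorem AlgebraicIndependent.card_le_of_mem_adjoin {k E ι : Type*} [Field k] [Field E] [Algebra k E]
    [Fintype ι] {z : ι → E} (hz : AlgebraicIndependent k z) (S : Finset E)
    (h : ∀ i, z i ∈ IntermediateField.adjoin k (S : Set E)) : Fintype.card ι ≤ S.card := by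
  have hind : (AlgebraicIndependent.matroid k E).Indep (Set.range z) := by
    rw [matroid_indep_iff]
    exact hz.coe_range
  have hsub : Set.range z ⊆ (AlgebraicIndependent.matroid k E).closure S := by
    rintro _ ⟨i, rfl⟩
    rw [matroid_closure_eq]
    have : IsAlgebraic (IntermediateField.adjoin k (S : Set E)) (z i) :=
      isAlgebraic_algebraMap (⟨z i, h i⟩ : IntermediateField.adjoin k (S : Set E))
    exact IntermediateField.isAlgebraic_adjoin_iff.1 this
  have h1 := hind.encard_le_eRk_of_subset hsub
  rw [Matroid.eRk_closure_eq] at h1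
  have h2 := h1.trans (Matroid.eRk_le_encard _ _)
  have hinj : Function.Injective z := hz.injective
  rw [← Set.image_univ, hinj.encard_image, Set.encard_univ, Set.encard_coe_eq_coe_finsetCard,
    ENat.card_eq_coe_fintype_card] at h2
  exact_mod_cast h2

section DiffRat

variable {m n : ℕ} {k : Type*} [Field k] [DiffRing m k]

instance : IsDiffAlgebra m k (DiffRat m n k) where
  δ_algebraMap i a := by
    rw [IsScalarTower.algebraMap_apply k (DiffPoly m n k), IsScalarTower.algebraMap_apply k
      (DiffPoly m n k)]
    refine (fracDerivation_algebraMap i _).trans ?_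
    exact congrArg _ (DiffPoly.derivation_C i a)

/-- The derivative `x_j^θ` of a variable as a rational differential function. -/
noncomputable def ratVar (v : Fin n × (Fin m → ℕ)) : DiffRat m n k :=
  algebraMap (DiffPoly m n k) (DiffRat m n k) (X v)

theorem δ_ratVar (i : Fin m) (v : Fin n × (Fin m → ℕ)) :
    δ i (ratVar (k := k) v) = ratVar (v.1, v.2 + Pi.single i 1) := by
  refine (fracDerivation_algebraMap i _).trans ?_
  exact congrArg _ (DiffPoly.derivation_X i v)

theorem deriv_ratVar (θ : Fin m → ℕ) (j : Fin n) :
    DiffRing.deriv θ (ratVar (k := k) (j, 0)) = ratVar (j, θ) := by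
  induction θ using exponent_induction with
  | zero => simp
  | step θ i ih => rw [deriv_add_single, ih, δ_ratVar]

/-- The partial derivative as the only member of a differential ring structure. -/
@[reducible]
noncomputable def pderivDiffRing (k : Type*) [Field k] (w : Fin n × (Fin m → ℕ)) :
    DiffRing 1 (DiffPoly m n k) where
  δ _ := (pderiv w : Derivation k (DiffPoly m n k) (DiffPoly m n k)).toLinearMap.toAddMonoidHom
  δ_mul _ a b := by
    simp [Derivation.leibniz]
  δ_comm i j a := rfl

/-- The partial derivative with respect to a derivative of a variable on rational differential
functions. -/
noncomputable def ratPDeriv (k : Type*) [Field k] (w : Fin n × (Fin m → ℕ)) :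
    DiffRat m n k →+ DiffRat m n k :=
  letI := pderivDiffRing k w
  fracDerivation (m := 1) 0

omit [DiffRing m k] in
theorem ratPDeriv_mul (w : Fin n × (Fin m → ℕ)) (a b : DiffRat m n k) :
    ratPDeriv k w (a * b) = a * ratPDeriv k w b + b * ratPDeriv k w a :=
  letI := pderivDiffRing k w
  fracDerivation_mul (m := 1) 0 a b

omit [DiffRing m k] in
theorem ratPDeriv_algebraMap (w : Fin n × (Fin m → ℕ)) (a : DiffPoly m n k) :
    ratPDeriv k w (algebraMap _ _ a) = algebraMap _ _ (pderiv w a) :=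
  letI := pderivDiffRing k w
  fracDerivation_algebraMap (m := 1) 0 a

omit [DiffRing m k] in
theorem ratPDeriv_const (w : Fin n × (Fin m → ℕ)) (a : k) :
    ratPDeriv k w (algebraMap k (DiffRat m n k) a) = 0 := by
  rw [IsScalarTower.algebraMap_apply k (DiffPoly m n k), ratPDeriv_algebraMap, algebraMap_eq,
    pderiv_C, map_zero]

omit [DiffRing m k] in
theorem ratPDeriv_ratVar (w v : Fin n × (Fin m → ℕ)) [Decidable (w = v)] :
    ratPDeriv k w (ratVar v) = if w = v then 1 else 0 := by
  classical
  rw [ratVar, ratPDeriv_algebraMap, pderiv_X, Pi.single_apply]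
  simp only [eq_comm (a := v)]
  split_ifs <;> simp

/-- By the product and quotient rules it is enough to control `δ i` on generators. `K` is allowed to
exceed the field generated by `S` because derivation raises the order. -/
theorem δ_mem_intermediateField {B : Type*} [Field B] [Algebra k B] [DiffRing m B]
    [IsDiffAlgebra m k B] (i : Fin m) (S : Set B) (K : IntermediateField k B) (hS : S ⊆ K)
    (h : ∀ x ∈ S, δ i x ∈ K) {x : B} (hx : x ∈ IntermediateField.adjoin k S) : δ i x ∈ K := by
  have hle : IntermediateField.adjoin k S ≤ K := IntermediateField.adjoin_le_iff.2 hS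
  induction hx using IntermediateField.adjoin_induction with
  | mem x hx => exact h x hx
  | algebraMap a => rw [IsDiffAlgebra.δ_algebraMap]; exact K.algebraMap_mem _
  | add x y _ _ hx hy => rw [map_add]; exact add_mem hx hy
  | inv x hx ih =>
    by_cases h0 : x = 0
    · simp [h0]
    · have h1 := δ_mul i x x⁻¹
      rw [mul_inv_cancel₀ h0, δ_one] at h1
      have h2 : δ i x⁻¹ = -(x⁻¹ * x⁻¹ * δ i x) := by
        refine mul_left_cancel₀ h0 ?_
        linear_combination -h1 + x⁻¹ * δ i x * mul_inv_cancel₀ h0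
      rw [h2]
      exact neg_mem (mul_mem (mul_mem (inv_mem (hle hx)) (inv_mem (hle hx))) ih)
  | mul x y hx hy ihx ihy =>
    rw [δ_mul]
    exact add_mem (mul_mem (hle hx) ihy) (mul_mem (hle hy) ihx)

/-- The rational differential functions in the derivatives of order at most `c`. -/
noncomputable def boundedOrder (k : Type*) [Field k] (c : Fin m → ℕ) :
    IntermediateField k (DiffRat m n k) :=
  IntermediateField.adjoin k (ratVar '' {v | v.2 ≤ c})

omit [DiffRing m k] in
theorem boundedOrder_mono {c c' : Fin m → ℕ} (h : c ≤ c') :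
    boundedOrder (n := n) k c ≤ boundedOrder k c' :=
  IntermediateField.adjoin.mono _ _ _ (Set.image_mono fun _ hv => le_trans hv h)

theorem deriv_mem_boundedOrder {c : Fin m → ℕ} {f : DiffRat m n k} (hf : f ∈ boundedOrder k c)
    (θ : Fin m → ℕ) : DiffRing.deriv θ f ∈ boundedOrder k (c + θ) := by
  induction θ using exponent_induction with
  | zero => simpa using hf
  | step θ i ih =>
    rw [deriv_add_single]
    have hle : c + θ ≤ c + (θ + Pi.single i 1) := by rw [← add_assoc]; exact le_self_add
    refine δ_mem_intermediateField i _ _ ?_ ?_ ih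
    · rintro _ ⟨v, hv, rfl⟩
      exact IntermediateField.subset_adjoin _ _ ⟨v, le_trans hv hle, rfl⟩
    · rintro _ ⟨v, hv, rfl⟩
      rw [δ_ratVar]
      refine IntermediateField.subset_adjoin _ _ ⟨_, ?_, rfl⟩
      change v.2 + Pi.single i 1 ≤ c + (θ + Pi.single i 1)
      rw [← add_assoc]
      exact add_le_add_left hv _

omit [DiffRing m k] in
theorem exists_mem_boundedOrder (f : DiffRat m n k) :
    ∃ d : ℕ, f ∈ boundedOrder k (fun _ => d) := by
  have hpoly : ∀ p : DiffPoly m n k, ∃ d : ℕ, algebraMap _ (DiffRat m n k) p ∈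
      boundedOrder k (fun _ => d) := by
    intro p
    have hmono : ∀ {d d' : ℕ}, d ≤ d' → boundedOrder (m := m) (n := n) k (fun _ => d) ≤
      boundedOrder k (fun _ => d') := fun h => boundedOrder_mono fun _ => h
    induction p using MvPolynomial.induction_on with
    | C a =>
      exact ⟨0, (boundedOrder k _).algebraMap_mem a⟩
    | add p q hp hq =>
      obtain ⟨d, hd⟩ := hp
      obtain ⟨d', hd'⟩ := hq
      refine ⟨max d d', ?_⟩
      rw [map_add]
      exact add_mem (hmono (le_max_left _ _) hd) (hmono (le_max_right _ _) hd')
    | mul_X p v hp =>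
      obtain ⟨d, hd⟩ := hp
      refine ⟨max d (Finset.univ.sup v.2), ?_⟩
      rw [map_mul]
      refine mul_mem (hmono (le_max_left _ _) hd) (IntermediateField.subset_adjoin _ _ ⟨v, ?_, rfl⟩)
      exact fun i => (Finset.le_sup (Finset.mem_univ i)).trans (le_max_right _ _)
  obtain ⟨a, b, -, rfl⟩ := IsFractionRing.div_surjective (A := DiffPoly m n k) f
  obtain ⟨d, hd⟩ := hpoly a
  obtain ⟨d', hd'⟩ := hpoly b
  exact ⟨max d d', div_mem (boundedOrder_mono (fun _ => le_max_left _ _) hd)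
    (boundedOrder_mono (fun _ => le_max_right _ _) hd')⟩

/-- There are at most `n` differentially independent elements in `k⟨x₁, …, x_n⟩`. -/
theorem length_le_of_not_diffAlgDependent {s : ℕ} (f : Fin s → DiffRat m n k)
    (hf : ¬ DiffAlgDependent m k f) : s ≤ n := by
  classical
  have hind : AlgebraicIndependent k
      (fun v : Fin s × (Fin m → ℕ) => DiffRing.deriv v.2 (f v.1)) := by
    rw [algebraicIndependent_iff]
    intro p hp
    by_contra h0
    exact hf ⟨p, h0, hp⟩
  choose d hd using fun i => exists_mem_boundedOrder (f i)
  refine le_of_forall_mul_pow_le (m := m) (c := Finset.univ.sup d) fun N => ?_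
  set c := Finset.univ.sup d
  let S : Finset (DiffRat m n k) :=
    (Finset.univ ×ˢ Finset.Iic (fun _ => N + c : Fin m → ℕ)).image ratVar
  have hι : Function.Injective (fun v : Fin s × Finset.Iic (fun _ => N : Fin m → ℕ) =>
      ((v.1, v.2.1) : Fin s × (Fin m → ℕ))) := by
    intro v w h
    exact Prod.ext (Prod.ext_iff.1 h).1 (Subtype.ext (Prod.ext_iff.1 h).2)
  -- The `s (N + 1)^m` independent derivatives of the `f i` by `θ ≤ N` lie in the field generated by
  -- the derivatives of the variables of exponent at most `N + c`.
  have hcard := (hind.comp _ hι).card_le_of_mem_adjoin S (by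
    rintro ⟨i, θ⟩
    have h1 := deriv_mem_boundedOrder (hd i) θ.1
    have h2 : (fun _ => d i) + θ.1 ≤ fun _ => N + c := by
      intro l
      have h3 : θ.1 l ≤ N := Finset.mem_Iic.1 θ.2 l
      have h4 : d i ≤ c := Finset.le_sup (Finset.mem_univ i)
      simp only [Pi.add_apply]
      omega
    have h3 := boundedOrder_mono h2 h1
    have h4 : (S : Set (DiffRat m n k)) = ratVar '' {v | v.2 ≤ fun _ => N + c} := by
      ext z
      simp [S]
    rw [h4]
    exact h3)
  have hS : S.card ≤ n * (N + c + 1) ^ m :=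
    Finset.card_image_le.trans (by simp [Finset.card_product, card_Iic_const])
  have hP : Fintype.card (Fin s × Finset.Iic (fun _ => N : Fin m → ℕ)) = s * (N + 1) ^ m := by
    rw [Fintype.card_prod, Fintype.card_fin, Fintype.card_coe, card_Iic_const]
  rw [hP] at hcard
  exact hcard.trans hS

end DiffRat

/-! ### Completion by variables as a certificate of independence. -/

section

variable {m n : ℕ} {k : Type*} [Field k] [DiffRing m k]

/-- The variables `x₁, …, x_n` as a list of rational differential functions. -/
noncomputable def ratVars (m n : ℕ) (k : Type*) [Field k] : List (DiffRat m n k) :=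
  (List.finRange n).map fun j => ratVar (j, 0)

/-- A system of differentially independent elements stays below `n` members when it is completed by
variables until all variables become differentially algebraic. -/
theorem exists_completion [CharZero k] (L : List (DiffRat m n k))
    (hL : ¬ ∃ q < L.length, DiffAlgOverPrev (m := m) k (fun j => L.getD j 0) q) :
    ∃ J : List (Fin n), L.length + J.length ≤ n ∧ ∀ j : Fin n, DiffAlgOverPrev (m := m) k
      (fun i => (L ++ J.map (fun j => ratVar (j, 0)) ++ ratVars m n k).getD i 0)
      (L.length + J.length + j) := by
  have hbound : ∀ L' : List (DiffRat m n k),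
      (¬ ∃ q < L'.length, DiffAlgOverPrev (m := m) k (fun j => L'.getD j 0) q) →
      L'.length ≤ n := by
    intro L' hL'
    refine length_le_of_not_diffAlgDependent L'.get ?_
    rwa [diffAlgDependent_iff _ (fun j => L'.getD j 0) (by intro i; simp)]
  -- Induction on the room left below `n`, for an independent system already enlarged by the
  -- variables in `J`.
  suffices H : ∀ (d : ℕ) (J : List (Fin n)), n - (L.length + J.length) = d →
      (¬ ∃ q < (L ++ J.map fun j => ratVar (j, 0)).length, DiffAlgOverPrev (m := m) k
        (fun i => (L ++ J.map fun j => ratVar (j, 0)).getD i 0) q) →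
      ∃ J : List (Fin n), L.length + J.length ≤ n ∧ ∀ j : Fin n, DiffAlgOverPrev (m := m) k
        (fun i => (L ++ J.map (fun j => ratVar (j, 0)) ++ ratVars m n k).getD i 0)
        (L.length + J.length + j) from
    H _ [] rfl (by simpa using hL)
  intro d
  induction d using Nat.strong_induction_on with
  | _ d ih =>
    intro J hd hJ
    have hlen := hbound _ hJ
    simp only [List.length_append, List.length_map] at hlen
    by_cases hall : ∀ j : Fin n, DiffAlgOverPrev (m := m) k
        (fun i => (L ++ J.map (fun j => ratVar (j, 0)) ++ ratVars m n k).getD i 0)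
        (L.length + J.length + j)
    · exact ⟨J, hlen, hall⟩
    · push Not at hall
      obtain ⟨j, hj⟩ := hall
      have hJ' : ¬ ∃ q < (L ++ (J ++ [j]).map fun j => ratVar (j, 0)).length,
          DiffAlgOverPrev (m := m) k
            (fun i => (L ++ (J ++ [j]).map fun j => ratVar (j, 0)).getD i 0) q := by
        rintro ⟨q, hq, h⟩
        simp only [List.length_append, List.length_map, List.length_singleton] at hq
        rcases (show q < L.length + J.length ∨ q = L.length + J.length by omega) with hq' | rfl
        · refine hJ ⟨q, by simpa using hq', h.of_swap le_rfl (fun i hi => ?_) ?_⟩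
          · rw [List.map_append, ← List.append_assoc,
              List.getD_append (L ++ J.map fun j => ratVar (j, 0)) _ _ _ (by simp; omega)]
          · rw [List.map_append, ← List.append_assoc,
              List.getD_append (L ++ J.map fun j => ratVar (j, 0)) _ _ _ (by simp; omega)]
        -- If `x_j` were algebraic over `L` and `J` alone, it would remain so after the insertion of
        -- the variables preceding `x_j`, against `hj`.
        · refine hj (h.of_swap (Nat.le_add_right _ _) (fun i hi => ?_) ?_)
          · rw [List.map_append, ← List.append_assoc,
              List.getD_append (L ++ J.map fun j => ratVar (j, 0)) _ _ _ (by simpa using hi),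
              List.getD_append (L ++ J.map fun j => ratVar (j, 0)) _ _ _ (by simpa using hi)]
          · rw [List.map_append, ← List.append_assoc,
              List.getD_append_right _ _ _ _ (by simp), List.getD_append_right _ _ _ _ (by simp)]
            simp [ratVars]
      have hlen' := hbound _ hJ'
      simp only [List.length_append, List.length_map, List.length_singleton] at hlen'
      -- The truncated difference really drops, since `hlen'` bounds the enlarged system by `n`.
      exact ih _ (by simp; omega) (J ++ [j]) rfl hJ'

/-- A relation inside `L` would be an algebraic place in addition to the `n` places of the final
variables, giving `(n + 1) + n ≤ L.length + J.length + n ≤ 2n`. -/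
theorem not_diffAlgOverPrev_of_completion (L : List (DiffRat m n k)) (J : List (Fin n))
    (hlen : L.length + J.length ≤ n)
    (h : ∀ j : Fin n, DiffAlgOverPrev (m := m) k
      (fun i => (L ++ J.map (fun j => ratVar (j, 0)) ++ ratVars m n k).getD i 0)
      (L.length + J.length + j)) :
    ¬ ∃ q < L.length, DiffAlgOverPrev (m := m) k (fun j => L.getD j 0) q := by
  classical
  rintro ⟨q, hq, hrel⟩
  have hrel' : DiffAlgOverPrev (m := m) k
      (fun i => (L ++ J.map (fun j => ratVar (j, 0)) ++ ratVars m n k).getD i 0) q := by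
    refine hrel.of_swap le_rfl (fun i hi => ?_) ?_ <;>
      rw [List.append_assoc, List.getD_append _ _ _ _ (by omega)]
  have := add_le_of_diffAlgOverPrev (m := m) (k := k) (T := n + 1) (n := n)
    (M := L.length + J.length + n)
    (fun i => (L ++ J.map (fun j => ratVar (j, 0)) ++ ratVars m n k).getD i 0) (ratPDeriv k)
    ratPDeriv_mul ratPDeriv_const
    (fun j => L.length + J.length + j) (by intro j; omega) (by
      intro w j θ
      rw [List.getD_append_right _ _ _ _ (by simp)]
      simp only [ratVars, List.length_append, List.length_map, Nat.add_sub_cancel_left]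
      rw [List.getD_eq_getElem _ _ (by simp)]
      simp only [List.getElem_map, List.getElem_finRange, Fin.cast_mk, Fin.eta]
      rw [deriv_ratVar, ratPDeriv_ratVar])
    (Fin.cons q fun j => L.length + J.length + j) (by
      intro a b hab
      induction b using Fin.cases with
      | zero => simp at hab
      | succ b =>
        induction a using Fin.cases with
        | zero => simp only [Fin.cons_zero, Fin.cons_succ]; omega
        | succ a => simpa using hab) (by
      intro t
      induction t using Fin.cases with
      | zero => simp; omega
      | succ t => simp) (by
      intro t
      induction t using Fin.cases with
      | zero => simpa using hrel'
      | succ t => simpa using h t)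
  omega

/-- This turns the absence of relations into the existence of a finite object, and so makes
independence semidecidable. -/
theorem not_diffAlgDependent_iff [CharZero k] (L : List (DiffRat m n k)) :
    (¬ ∃ q < L.length, DiffAlgOverPrev (m := m) k (fun j => L.getD j 0) q) ↔
    ∃ J : List (Fin n), L.length + J.length ≤ n ∧ ∀ j : Fin n, DiffAlgOverPrev (m := m) k
      (fun i => (L ++ J.map (fun j => ratVar (j, 0)) ++ ratVars m n k).getD i 0)
      (L.length + J.length + j) :=
  ⟨exists_completion L, fun ⟨J, hlen, h⟩ => not_diffAlgOverPrev_of_completion L J hlen h⟩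

end

/-! ### Computable list operations and unbounded search. -/

section Computability

variable {α β γ σ : Type*} [Primcodable α] [Primcodable β] [Primcodable γ] [Primcodable σ]

theorem Computable.list_foldl {f : α → List β} {g : α → σ} {h : α → σ → β → σ} (hf : Computable f)
    (hg : Computable g) (hh : Computable fun p : (α × σ) × β => h p.1.1 p.1.2 p.2) :
    Computable fun a => (f a).foldl (h a) (g a) := by
  have key : Computable fun a => Nat.rec (motive := fun _ => σ) (g a)
      (fun i s => Option.casesOn ((f a)[i]?) s fun b => h a s b) (f a).length := by
    refine Computable.nat_rec (h := fun a (p : ℕ × σ) =>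
      Option.casesOn ((f a)[p.1]?) p.2 fun b => h a p.2 b)
      (Computable.list_length.comp hf) hg ?_
    refine Computable.option_casesOn (o := fun q : α × ℕ × σ => (f q.1)[q.2.1]?)
      (f := fun q => q.2.2) (g := fun q b => h q.1 q.2.2 b) ?_ ?_ ?_
    · exact Computable₂.comp (f := fun (l : List β) (i : ℕ) => l[i]?)
        (g := fun q : α × ℕ × σ => f q.1) (h := fun q => q.2.1) Computable.list_getElem?
        (hf.comp Computable.fst) (Computable.fst.comp Computable.snd)
    · exact Computable.snd.comp Computable.snd
    · exact hh.comp (g := fun q : (α × ℕ × σ) × β => ((q.1.1, q.1.2.2), q.2))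
        (Computable.pair (Computable.pair (Computable.fst.comp Computable.fst)
        (Computable.snd.comp (Computable.snd.comp Computable.fst))) Computable.snd)
  refine key.of_eq fun a => ?_
  -- The recursion reads entries of the whole list by index, so the invariant must speak of a prefix
  -- `l'` of a fixed `l`.
  have : ∀ l' l : List β, l' <+: l → Nat.rec (motive := fun _ => σ) (g a)
      (fun i s => Option.casesOn (l[i]?) s fun b => h a s b) l'.length = l'.foldl (h a) (g a) := by
    intro l'
    induction l' using List.reverseRecOn with
    | nil => intro l _; rfl
    | append_singleton l' b ih =>
      intro l hl
      have h1 : l[l'.length]? = some b := by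
        obtain ⟨r, rfl⟩ := hl
        simp
      have h2 := ih l ((List.prefix_append _ _).trans hl)
      simp only [List.length_append, List.length_singleton, List.foldl_append, List.foldl_cons,
        List.foldl_nil, ← h2, h1]
  exact this _ _ (List.prefix_refl _)

theorem Computable.append {f g : α → List β} (hf : Computable f) (hg : Computable g) :
    Computable fun a => f a ++ g a :=
  Computable₂.comp (f := fun l₁ l₂ : List β => l₁ ++ l₂) Computable.list_append hf hg

theorem Computable.singleton {f : α → β} (hf : Computable f) : Computable fun a => [f a] :=
  Computable₂.comp (f := List.cons) Computable.list_cons hf (Computable.const [])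

theorem Computable.list_map {f : α → List β} {g : α → β → σ} (hf : Computable f)
    (hg : Computable fun p : α × β => g p.1 p.2) : Computable fun a => (f a).map (g a) := by
  refine (Computable.list_foldl (h := fun a l b => l ++ [g a b]) hf (Computable.const []) ?_).of_eq
    fun a => ?_
  · exact Computable.append (Computable.snd.comp Computable.fst) (Computable.singleton
      (hg.comp (g := fun q : (α × List σ) × β => (q.1.1, q.2))
        (Computable.pair (Computable.fst.comp Computable.fst) Computable.snd)))
  · induction f a using List.reverseRecOn with
    | nil => rfl
    | append_singleton l b ih => simp [ih]

theorem Computable.list_all {f : α → List β} {p : α → β → Bool} (hf : Computable f)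
    (hp : Computable fun q : α × β => p q.1 q.2) : Computable fun a => (f a).all (p a) := by
  refine (Computable.list_foldl (h := fun a t b => bif t then p a b else false) hf
    (Computable.const true) ?_).of_eq fun a => ?_
  · exact Computable.cond (Computable.snd.comp Computable.fst)
      (hp.comp (g := fun q : (α × Bool) × β => (q.1.1, q.2))
        (Computable.pair (Computable.fst.comp Computable.fst) Computable.snd))
      (Computable.const false)
  · induction f a using List.reverseRecOn with
    | nil => rfl
    | append_singleton l b ih =>
      rw [List.foldl_append, ih, List.all_append]
      cases l.all (p a) <;> simp

theorem Computable.iterate {f : α → ℕ} {g : α → σ} {h : σ → σ} (hf : Computable f)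
    (hg : Computable g) (hh : Computable h) : Computable fun a => h^[f a] (g a) := by
  refine (Computable.nat_rec (h := fun _ (p : ℕ × σ) => h p.2) hf hg
    (hh.comp (Computable.snd.comp Computable.snd))).of_eq fun a => ?_
  induction f a with
  | zero => rfl
  | succ n ih => rw [Function.iterate_succ_apply', ← ih]

theorem Computable.beq [DecidableEq β] {f g : α → β} (hf : Computable f) (hg : Computable g) :
    Computable fun a => f a == g a :=
  Primrec.beq.to_comp.comp hf hg

theorem Computable.list_count [DecidableEq β] {f : α → β} {l : α → List β} (hf : Computable f)
    (hl : Computable l) : Computable fun a => (l a).count (f a) := by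
  refine (Computable.list_foldl (h := fun a s b => bif b == f a then s + 1 else s) hl
    (Computable.const 0) ?_).of_eq fun a => ?_
  · exact Computable.cond (Computable.beq Computable.snd
      (hf.comp (Computable.fst.comp Computable.fst)))
      (Computable.succ.comp (Computable.snd.comp Computable.fst))
      (Computable.snd.comp Computable.fst)
  · induction l a using List.reverseRecOn with
    | nil => rfl
    | append_singleton l b ih =>
      rw [List.foldl_append, ih, List.count_append, List.count_singleton, List.foldl_cons,
        List.foldl_nil]
      cases b == f a <;> simp

/-- Run through all natural numbers, decode each as a candidate `b`, and stop at the first that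
passes `c a`. -/
theorem REPred.exists_of_computable {c : α → β → Bool}
    (hc : Computable fun p : α × β => c p.1 p.2) : REPred fun a => ∃ b, c a b = true := by
  have h : Partrec fun a => Nat.rfindOpt fun i =>
      (Encodable.decode (α := β) i).bind fun b => bif c a b then some () else none := by
    refine Partrec.rfindOpt ?_
    refine Computable.option_bind (f := fun p : α × ℕ => Encodable.decode (α := β) p.2)
      (g := fun p b => bif c p.1 b then some () else none)
      (Computable.decode.comp Computable.snd) ?_
    exact Computable.cond (hc.comp (g := fun q : (α × ℕ) × β => (q.1.1, q.2))
      (Computable.pair (Computable.fst.comp Computable.fst) Computable.snd))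
      (Computable.const _) (Computable.const _)
  refine h.dom_re.of_eq fun a => ?_
  rw [Nat.rfindOpt_dom]
  constructor
  · rintro ⟨i, u, hu⟩
    rw [Option.mem_def, Option.bind_eq_some_iff] at hu
    obtain ⟨b, -, hb⟩ := hu
    refine ⟨b, ?_⟩
    cases hcb : c a b
    · simp [hcb] at hb
    · rfl
  · rintro ⟨b, hb⟩
    exact ⟨Encodable.encode b, (), by simp [hb]⟩

end Computability

/-! ### Written forms of polynomials -/

/-- Written form of a polynomial in the variables `V`: a list of terms, each consisting of the
number of a coefficient and a list of variables. -/
abbrev TermList (V : Type) : Type := List (ℕ × List V)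

namespace TermList

variable {V : Type}

/-- The polynomial denoted by a list of terms, with coefficients numbered by `ν`. -/
noncomputable def toPoly {k : Type*} [CommRing k] (ν : ℕ → k) (c : TermList V) : MvPolynomial V k :=
  (c.map fun t => C (ν t.1) * (t.2.map X).prod).sum

/-- The product of two lists of terms. -/
def mul (s : ℕ → ℕ → ℕ) (a b : TermList V) : TermList V :=
  a.foldl (fun acc t => acc ++ b.map fun u => (s t.1 u.1, t.2 ++ u.2)) []

/-- The image of a term under the derivation given by `d` on the coefficients and by `dv` on the
variables. -/
def derivTerm (s : ℕ → ℕ → ℕ) (one : ℕ) (d : ℕ → ℕ) (dv : V → TermList V) (t : ℕ × List V) :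
    TermList V :=
  (t.2.foldl (fun st v => (st.1 ++ [v], mul s st.2 [(one, [v])] ++ mul s [(t.1, st.1)] (dv v)))
    (([], [(d t.1, [])]) : List V × TermList V)).2

/-- The image of a list of terms under the derivation given by `d` on the coefficients and by `dv`
on the variables. -/
def deriv (s : ℕ → ℕ → ℕ) (one : ℕ) (d : ℕ → ℕ) (dv : V → TermList V) (c : TermList V) :
    TermList V :=
  c.foldl (fun acc t => acc ++ derivTerm s one d dv t) []

/-- Equality of monomials. -/
def sameMonomial [DecidableEq V] (l l' : List V) : Bool :=
  (l ++ l').all fun a => l.count a == l'.count a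

/-- The zero test: all coefficients of monomials vanish. -/
def isZero [DecidableEq V] (add : ℕ → ℕ → ℕ) (z₀ : ℕ) (z : ℕ → Bool) (c : TermList V) : Bool :=
  c.all fun t => z (c.foldl (fun acc u => bif sameMonomial u.2 t.2 then add acc u.1 else acc) z₀)

/-- The value of a list of terms under an assignment of the coefficients and variables. -/
def eval {α : Type*} (add mul : α → α → α) (z₀ : α) (cst : ℕ → α) (E : V → α) (c : TermList V) :
    α :=
  c.foldl (fun acc t => add acc (t.2.foldl (fun s v => mul s (E v)) (cst t.1))) z₀

section Correctness

variable {k : Type*} [CommRing k] {ν : ℕ → k}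

@[simp]
theorem toPoly_nil : toPoly ν ([] : TermList V) = 0 := rfl

@[simp]
theorem toPoly_append (a b : TermList V) : toPoly ν (a ++ b) = toPoly ν a + toPoly ν b := by
  simp [toPoly]

@[simp]
theorem toPoly_cons (t : ℕ × List V) (b : TermList V) :
    toPoly ν (t :: b) = C (ν t.1) * (t.2.map X).prod + toPoly ν b := by
  simp [toPoly]

theorem toPoly_map_term {s : ℕ → ℕ → ℕ} (hs : ∀ a b, ν (s a b) = ν a * ν b) (t : ℕ × List V)
    (b : TermList V) : toPoly ν (b.map fun u => (s t.1 u.1, t.2 ++ u.2)) =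
      C (ν t.1) * (t.2.map X).prod * toPoly ν b := by
  induction b with
  | nil => simp
  | cons u b ih =>
    rw [List.map_cons, toPoly_cons, ih, toPoly_cons]
    simp only [hs, C_mul, List.map_append, List.prod_append]
    ring

theorem toPoly_mul {s : ℕ → ℕ → ℕ} (hs : ∀ a b, ν (s a b) = ν a * ν b) (a b : TermList V) :
    toPoly ν (mul s a b) = toPoly ν a * toPoly ν b := by
  unfold mul
  induction a using List.reverseRecOn with
  | nil => simp
  | append_singleton a t ih =>
    rw [List.foldl_append, List.foldl_cons, List.foldl_nil, toPoly_append, ih, toPoly_map_term hs]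
    simp [add_mul]

variable {D : MvPolynomial V k →+ MvPolynomial V k} {s : ℕ → ℕ → ℕ} {one : ℕ} {d : ℕ → ℕ}
  {dv : V → TermList V}

/-- The fold carries a prefix of the monomial and the derivative of the coefficient times that
prefix, updated by the product rule. `D` is left abstract so that one procedure serves both `δᵢ` and
the partial derivatives. -/
theorem toPoly_derivTerm (hD : ∀ p q, D (p * q) = p * D q + q * D p)
    (hs : ∀ a b, ν (s a b) = ν a * ν b) (hone : ν one = 1) (hd : ∀ a, C (ν (d a)) = D (C (ν a)))
    (hdv : ∀ v, toPoly ν (dv v) = D (X v)) (t : ℕ × List V) :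
    toPoly ν (derivTerm s one d dv t) = D (C (ν t.1) * (t.2.map X).prod) := by
  obtain ⟨a, l⟩ := t
  suffices H : (l.foldl (fun st v =>
      (st.1 ++ [v], mul s st.2 [(one, [v])] ++ mul s [(a, st.1)] (dv v)))
      (([], [(d a, [])]) : List V × TermList V)).1 = l ∧
      toPoly ν (l.foldl (fun st v => (st.1 ++ [v], mul s st.2 [(one, [v])] ++
        mul s [(a, st.1)] (dv v))) (([], [(d a, [])]) : List V × TermList V)).2 =
      D (C (ν a) * (l.map X).prod) from H.2
  induction l using List.reverseRecOn with
  | nil => simp [hd]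
  | append_singleton l v ih =>
    rw [List.foldl_append, List.foldl_cons, List.foldl_nil]
    refine ⟨by rw [ih.1], ?_⟩
    rw [toPoly_append, toPoly_mul hs, toPoly_mul hs, ih.1, ih.2, hdv]
    simp only [toPoly_cons, toPoly_nil, hone, List.map_append, List.prod_append, List.map_cons,
      List.map_nil, List.prod_cons, List.prod_nil, C_1, mul_one, one_mul, add_zero, ← mul_assoc, hD]
    ring

theorem toPoly_deriv (hD : ∀ p q, D (p * q) = p * D q + q * D p)
    (hs : ∀ a b, ν (s a b) = ν a * ν b) (hone : ν one = 1) (hd : ∀ a, C (ν (d a)) = D (C (ν a)))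
    (hdv : ∀ v, toPoly ν (dv v) = D (X v)) (c : TermList V) :
    toPoly ν (deriv s one d dv c) = D (toPoly ν c) := by
  unfold deriv
  induction c using List.reverseRecOn with
  | nil => simp
  | append_singleton c t ih =>
    rw [List.foldl_append, List.foldl_cons, List.foldl_nil, toPoly_append, ih,
      toPoly_derivTerm hD hs hone hd hdv]
    simp

theorem sameMonomial_iff [DecidableEq V] {l l' : List V} :
    sameMonomial l l' = true ↔ l.Perm l' := by
  rw [sameMonomial, List.all_eq_true, List.perm_iff_count]
  simp only [List.mem_append, beq_iff_eq]
  refine ⟨fun h a => ?_, fun h a _ => h a⟩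
  by_cases ha : a ∈ l ∨ a ∈ l'
  · exact h a ha
  · push Not at ha
    rw [List.count_eq_zero_of_not_mem ha.1, List.count_eq_zero_of_not_mem ha.2]

theorem prod_map_X [DecidableEq V] (l : List V) :
    (l.map X).prod = (monomial (Multiset.toFinsupp (l : Multiset V)) 1 : MvPolynomial V k) := by
  induction l with
  | nil => simp
  | cons v l ih =>
    rw [List.map_cons, List.prod_cons, ih, X, monomial_mul, one_mul, ← Multiset.cons_coe,
      ← Multiset.singleton_add, map_add, Multiset.toFinsupp_singleton]

/-- Written forms need not be reduced: the coefficient of a monomial is the sum over all terms whose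
variable lists are permutations of `l`. -/
theorem coeff_toPoly [DecidableEq V] {add : ℕ → ℕ → ℕ} (hadd : ∀ a b, ν (add a b) = ν a + ν b)
    {z₀ : ℕ} (hzero : ν z₀ = 0) (l : List V) (c : TermList V) :
    coeff (Multiset.toFinsupp (l : Multiset V)) (toPoly ν c) =
      ν (c.foldl (fun acc u => bif sameMonomial u.2 l then add acc u.1 else acc) z₀) := by
  induction c using List.reverseRecOn with
  | nil => simp [hzero]
  | append_singleton c t ih =>
    rw [toPoly_append, coeff_add, ih, List.foldl_append, List.foldl_cons, List.foldl_nil]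
    have h : coeff (Multiset.toFinsupp (l : Multiset V)) (toPoly ν [t]) =
        bif sameMonomial t.2 l then ν t.1 else 0 := by
      rw [toPoly_cons, toPoly_nil, add_zero, prod_map_X, coeff_C_mul, coeff_monomial]
      cases hsame : sameMonomial t.2 l
      · rw [if_neg, mul_zero, cond_false]
        intro h
        rw [Multiset.toFinsupp.injective.eq_iff, Multiset.coe_eq_coe, ← sameMonomial_iff,
          hsame] at h
        exact absurd h (by simp)
      · rw [sameMonomial_iff, ← Multiset.coe_eq_coe] at hsame
        rw [if_pos (congrArg _ hsame), mul_one, cond_true]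
    rw [h]
    cases sameMonomial t.2 l <;> simp [hadd]

/-- Only monomials written in `c` can have a nonzero coefficient, so finitely many tests in `k`
suffice. -/
theorem isZero_iff [DecidableEq V] {add : ℕ → ℕ → ℕ} (hadd : ∀ a b, ν (add a b) = ν a + ν b)
    {z₀ : ℕ} (hzero : ν z₀ = 0) {z : ℕ → Bool} (hz : ∀ a, z a = true ↔ ν a = 0)
    (c : TermList V) : isZero add z₀ z c = true ↔ toPoly ν c = 0 := by
  rw [isZero, List.all_eq_true]
  simp only [hz, ← coeff_toPoly hadd hzero]
  refine ⟨fun h => ?_, fun h => by simp [h]⟩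
  ext d
  rw [coeff_zero]
  by_cases hd : ∃ t ∈ c, Multiset.toFinsupp (t.2 : Multiset V) = d
  · obtain ⟨t, ht, rfl⟩ := hd
    exact h t ht
  · push Not at hd
    clear h
    induction c with
    | nil => simp
    | cons t c ih =>
      rw [toPoly_cons, coeff_add, ih fun t' ht' => hd t' (List.mem_cons_of_mem _ ht'), add_zero,
        prod_map_X, coeff_C_mul, coeff_monomial, if_neg (hd t List.mem_cons_self), mul_zero]

theorem forall_mem_mul {s : ℕ → ℕ → ℕ} {S : Set V} {c c' : TermList V}
    (hc : ∀ t ∈ c, ∀ v ∈ t.2, v ∈ S) (hc' : ∀ t ∈ c', ∀ v ∈ t.2, v ∈ S) :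
    ∀ t ∈ mul s c c', ∀ v ∈ t.2, v ∈ S := by
  unfold mul
  induction c using List.reverseRecOn with
  | nil => simp
  | append_singleton c u ih =>
    intro t ht
    rw [List.foldl_append, List.foldl_cons, List.foldl_nil, List.mem_append] at ht
    rcases ht with h | h
    · exact ih (fun t ht => hc t (List.mem_append_left _ ht)) t h
    · obtain ⟨w, hw, rfl⟩ := List.mem_map.1 h
      intro v hv
      rcases List.mem_append.1 hv with h | h
      exacts [hc u (by simp) v h, hc' w hw v h]

/-- Since `ν` is onto, a search through codes misses no relation; the restriction on the variables
survives in the code. -/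
theorem exists_toPoly_eq (hν : Function.Surjective ν) {s : ℕ → ℕ → ℕ}
    (hs : ∀ a b, ν (s a b) = ν a * ν b) {S : Set V} {p : MvPolynomial V k}
    (hp : p ∈ supported k S) :
    ∃ c : TermList V, (∀ t ∈ c, ∀ v ∈ t.2, v ∈ S) ∧ toPoly ν c = p := by
  induction hp using Algebra.adjoin_induction with
  | mem x hx =>
    obtain ⟨v, hv, rfl⟩ := hx
    obtain ⟨a, ha⟩ := hν 1
    exact ⟨[(a, [v])], by simpa using hv, by simp [ha]⟩
  | algebraMap r =>
    obtain ⟨a, rfl⟩ := hν r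
    exact ⟨[(a, [])], by simp, by simp [algebraMap_eq]⟩
  | add x y _ _ hx hy =>
    obtain ⟨c, hc, rfl⟩ := hx
    obtain ⟨c', hc', rfl⟩ := hy
    refine ⟨c ++ c', ?_, toPoly_append c c'⟩
    intro t ht
    rcases List.mem_append.1 ht with h | h
    exacts [hc t h, hc' t h]
  | mul x y _ _ hx hy =>
    obtain ⟨c, hc, rfl⟩ := hx
    obtain ⟨c', hc', rfl⟩ := hy
    refine ⟨mul s c c', ?_, toPoly_mul hs c c'⟩
    exact forall_mem_mul hc hc'

theorem toPoly_mem_supported {S : Set V} {c : TermList V} (hc : ∀ t ∈ c, ∀ v ∈ t.2, v ∈ S) :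
    toPoly ν c ∈ supported k S := by
  induction c with
  | nil => simp
  | cons t c ih =>
    rw [toPoly_cons]
    refine add_mem (mul_mem ((supported k S).algebraMap_mem _) (list_prod_mem ?_))
      (ih fun t' ht' => hc t' (List.mem_cons_of_mem _ ht'))
    intro x hx
    obtain ⟨v, hv, rfl⟩ := List.mem_map.1 hx
    exact Algebra.subset_adjoin ⟨v, hc t List.mem_cons_self v hv, rfl⟩

/-- Denotation is a relation because a code, such as a fraction with zero denominator, may denote
nothing; closure of `rep` under the operations is all that evaluation needs. -/
theorem rep_eval {α R : Type*} [CommRing R] [Algebra k R] {rep : α → R → Prop} {add mul : α → α → α}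
    {z₀ : α} {cst : ℕ → α} {E : V → α} {x : V → R}
    (hadd : ∀ a b x y, rep a x → rep b y → rep (add a b) (x + y))
    (hmul : ∀ a b x y, rep a x → rep b y → rep (mul a b) (x * y)) (hzero : rep z₀ 0)
    (hcst : ∀ a, rep (cst a) (algebraMap k R (ν a))) (hE : ∀ v, rep (E v) (x v)) (c : TermList V) :
    rep (eval add mul z₀ cst E c) (aeval x (toPoly ν c)) := by
  unfold eval
  induction c using List.reverseRecOn with
  | nil => simpa using hzero
  | append_singleton c t ih =>
    rw [List.foldl_append, List.foldl_cons, List.foldl_nil, toPoly_append, map_add]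
    refine hadd _ _ _ _ ih ?_
    rw [toPoly_cons, toPoly_nil, add_zero]
    generalize t.2 = l
    induction l using List.reverseRecOn with
    | nil => simpa using hcst t.1
    | append_singleton l v ihl =>
      rw [List.foldl_append, List.foldl_cons, List.foldl_nil]
      have := hmul _ _ _ _ ihl (hE v)
      simpa [mul_assoc] using this

end Correctness

end TermList

/-! ### Computability of the operations on written polynomials. -/

namespace TermList

variable {V : Type} {α β : Type*} [Primcodable α] [Primcodable β] [Primcodable V]

theorem computable_mul {s : ℕ → ℕ → ℕ} (hs : Computable₂ s) :
    Computable₂ (mul s : TermList V → TermList V → TermList V) := by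
  have hterm : Computable fun q : (((TermList V × TermList V) × TermList V) × ℕ × List V) ×
      ℕ × List V => (s q.1.2.1 q.2.1, q.1.2.2 ++ q.2.2) := by
    have h1 : Computable fun q : (((TermList V × TermList V) × TermList V) × ℕ × List V) ×
        ℕ × List V => q.1.2 := Computable.snd.comp Computable.fst
    have h2 : Computable fun q : (((TermList V × TermList V) × TermList V) × ℕ × List V) ×
        ℕ × List V => q.2 := Computable.snd
    have h3 := hs.comp (Computable.fst.comp h1) (Computable.fst.comp h2)
    have h4 := Computable.append (Computable.snd.comp h1) (Computable.snd.comp h2)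
    exact Computable.pair h3 h4
  have hb : Computable fun q : ((TermList V × TermList V) × TermList V) × ℕ × List V => q.1.1.2 :=
    Computable.snd.comp (Computable.fst.comp Computable.fst)
  have hacc : Computable fun q : ((TermList V × TermList V) × TermList V) × ℕ × List V => q.1.2 :=
    Computable.snd.comp Computable.fst
  have hmap := Computable.list_map (g := fun (q : ((TermList V × TermList V) × TermList V) × ℕ ×
    List V) (u : ℕ × List V) => (s q.2.1 u.1, q.2.2 ++ u.2)) hb hterm
  have hstep := Computable.append hacc hmap
  have hfold := Computable.list_foldl (α := TermList V × TermList V)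
    (h := fun (p : TermList V × TermList V) (acc : TermList V) (t : ℕ × List V) =>
      acc ++ p.2.map fun u => (s t.1 u.1, t.2 ++ u.2))
    Computable.fst (Computable.const []) hstep
  exact hfold

/-- The parameter in `β` lets the derivation be part of the input, as required when the variable of
a partial derivative is found by search. -/
theorem computable_derivTerm {s : ℕ → ℕ → ℕ} (hs : Computable₂ s) (one : ℕ) {d : ℕ → ℕ}
    (hd : Computable d) {dv : β → V → TermList V} (hdv : Computable₂ dv) :
    Computable fun p : β × ℕ × List V => derivTerm s one d (dv p.1) p.2 := by
  have hm := computable_mul (V := V) hs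
  have h1 : Computable fun q : ((β × ℕ × List V) × List V × TermList V) × V => q.2 :=
    Computable.snd
  have h2 : Computable fun q : ((β × ℕ × List V) × List V × TermList V) × V => q.1.2.1 :=
    Computable.fst.comp (Computable.snd.comp Computable.fst)
  have h3 : Computable fun q : ((β × ℕ × List V) × List V × TermList V) × V => q.1.2.2 :=
    Computable.snd.comp (Computable.snd.comp Computable.fst)
  have h4 : Computable fun q : ((β × ℕ × List V) × List V × TermList V) × V => q.1.1.1 :=
    Computable.fst.comp (Computable.fst.comp Computable.fst)
  have h5 : Computable fun q : ((β × ℕ × List V) × List V × TermList V) × V => q.1.1.2.1 :=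
    Computable.fst.comp (Computable.snd.comp (Computable.fst.comp Computable.fst))
  have h6 := Computable.singleton (Computable.pair (Computable.const one) (Computable.singleton h1))
  have h7 := Computable.singleton (Computable.pair h5 h2)
  have hstep := Computable.pair (Computable.append h2 (Computable.singleton h1))
    (Computable.append (hm.comp h3 h6) (hm.comp h7 (hdv.comp h4 h1)))
  have h8 : Computable fun p : β × ℕ × List V => p.2.2 := Computable.snd.comp Computable.snd
  have h9 : Computable fun p : β × ℕ × List V => p.2.1 := Computable.fst.comp Computable.snd
  have hinit := Computable.pair (Computable.const (α := β × ℕ × List V) ([] : List V))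
    (Computable.singleton (Computable.pair (hd.comp h9) (Computable.const ([] : List V))))
  have hfold := Computable.list_foldl
    (h := fun (p : β × ℕ × List V) (st : List V × TermList V) (v : V) =>
    (st.1 ++ [v], mul s st.2 [(one, [v])] ++ mul s [(p.2.1, st.1)] (dv p.1 v))) h8 hinit hstep
  exact Computable.snd.comp hfold

theorem computable_deriv {s : ℕ → ℕ → ℕ} (hs : Computable₂ s) (one : ℕ) {d : ℕ → ℕ}
    (hd : Computable d) {dv : β → V → TermList V} (hdv : Computable₂ dv) :
    Computable fun p : β × TermList V => deriv s one d (dv p.1) p.2 := by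
  have h1 : Computable fun q : ((β × TermList V) × TermList V) × ℕ × List V => q.1.2 :=
    Computable.snd.comp Computable.fst
  have h2 : Computable fun q : ((β × TermList V) × TermList V) × ℕ × List V => (q.1.1.1, q.2) :=
    Computable.pair (Computable.fst.comp (Computable.fst.comp Computable.fst)) Computable.snd
  have h3 := (computable_derivTerm hs one hd hdv).comp h2
  have hstep := Computable.append h1 h3
  have hfold := Computable.list_foldl (α := β × TermList V)
    (h := fun (p : β × TermList V) (acc : TermList V) (t : ℕ × List V) =>
      acc ++ derivTerm s one d (dv p.1) t)
    Computable.snd (Computable.const []) hstep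
  exact hfold

theorem computable_sameMonomial [DecidableEq V] :
    Computable₂ (sameMonomial : List V → List V → Bool) := by
  have h1 : Computable fun q : (List V × List V) × V => q.1.1 :=
    Computable.fst.comp Computable.fst
  have h2 : Computable fun q : (List V × List V) × V => q.1.2 :=
    Computable.snd.comp Computable.fst
  have h3 := Computable.beq (Computable.list_count Computable.snd h1)
    (Computable.list_count Computable.snd h2)
  have hall := Computable.list_all
    (p := fun (q : List V × List V) (a : V) => q.1.count a == q.2.count a)
    (Computable.append Computable.fst Computable.snd) h3
  exact hall

theorem computable_isZero [DecidableEq V] {add : ℕ → ℕ → ℕ} (hadd : Computable₂ add) (z₀ : ℕ)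
    {z : ℕ → Bool} (hz : Computable z) :
    Computable (isZero add z₀ z : TermList V → Bool) := by
  have h0 : Computable fun q : ((TermList V × ℕ × List V) × ℕ) × ℕ × List V => q.2.2 :=
    Computable.snd.comp Computable.snd
  have h1 : Computable fun q : ((TermList V × ℕ × List V) × ℕ) × ℕ × List V => q.1.1.2.2 :=
    Computable.snd.comp (Computable.snd.comp (Computable.fst.comp Computable.fst))
  have h2 : Computable fun q : ((TermList V × ℕ × List V) × ℕ) × ℕ × List V => q.1.2 :=
    Computable.snd.comp Computable.fst
  have h3 : Computable fun q : ((TermList V × ℕ × List V) × ℕ) × ℕ × List V => q.2.1 :=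
    Computable.fst.comp Computable.snd
  have hsame := computable_sameMonomial.comp h0 h1
  have hstep := Computable.cond hsame (hadd.comp h2 h3) h2
  have hfold := Computable.list_foldl (α := TermList V × ℕ × List V)
    (h := fun (p : TermList V × ℕ × List V) (acc : ℕ) (u : ℕ × List V) =>
      bif sameMonomial u.2 p.2.2 then add acc u.1 else acc)
    Computable.fst (Computable.const z₀) hstep
  have hz' : Computable fun q : TermList V × ℕ × List V => z (q.1.foldl
      (fun acc u => bif sameMonomial u.2 q.2.2 then add acc u.1 else acc) z₀) := hz.comp hfold
  have hall := Computable.list_all (f := fun c : TermList V => c)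
    (p := fun (c : TermList V) (t : ℕ × List V) =>
    z (c.foldl (fun acc u => bif sameMonomial u.2 t.2 then add acc u.1 else acc) z₀))
    Computable.id hz'
  exact hall

theorem computable_eval {add mul : α → α → α} (hadd : Computable₂ add) (hmul : Computable₂ mul)
    (z₀ : α) {cst : ℕ → α} (hcst : Computable cst) {E : β → V → α} (hE : Computable₂ E) :
    Computable fun p : β × TermList V => eval add mul z₀ cst (E p.1) p.2 := by
  have h1 : Computable fun q : ((((β × TermList V) × α) × ℕ × List V) × α) × V => q.1.2 :=
    Computable.snd.comp Computable.fst
  have h2 : Computable fun q : ((((β × TermList V) × α) × ℕ × List V) × α) × V => q.1.1.1.1.1 :=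
    Computable.fst.comp
      (Computable.fst.comp (Computable.fst.comp (Computable.fst.comp Computable.fst)))
  have hstep := hmul.comp h1 (hE.comp h2 Computable.snd)
  have h3 : Computable fun q : ((β × TermList V) × α) × ℕ × List V => q.2.2 :=
    Computable.snd.comp Computable.snd
  have h4 : Computable fun q : ((β × TermList V) × α) × ℕ × List V => q.2.1 :=
    Computable.fst.comp Computable.snd
  have h5 : Computable fun q : ((β × TermList V) × α) × ℕ × List V => q.1.2 :=
    Computable.snd.comp Computable.fst
  have hterm := Computable.list_foldl
    (h := fun (q : ((β × TermList V) × α) × ℕ × List V) (s : α) (v : V) => mul s (E q.1.1.1 v)) h3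
    (hcst.comp h4) hstep
  have hstep' := hadd.comp h5 hterm
  have hfold := Computable.list_foldl (α := β × TermList V)
    (h := fun (p : β × TermList V) (acc : α) (t : ℕ × List V) =>
      add acc (t.2.foldl (fun s v => mul s (E p.1 v)) (cst t.1)))
    Computable.snd (Computable.const z₀) hstep'
  exact hfold

end TermList

/-! ### Effective numberings of `k`, `k{x₁, …, x_n}` and its field of fractions. -/

/-- The relation `rep`, read as "the code `a` denotes the element `x`", makes the ring operations,
the derivations and the zero test of `R` computable. -/
structure EffectiveNumbering (m : ℕ) {α R : Type*} [Primcodable α] [CommRing R] [DiffRing m R]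
    (rep : α → R → Prop) : Prop where
  one : ∃ a, rep a 1
  negOne : ∃ a, rep a (-1)
  add : ∃ s : α → α → α, Computable₂ s ∧ ∀ a b x y, rep a x → rep b y → rep (s a b) (x + y)
  mul : ∃ s : α → α → α, Computable₂ s ∧ ∀ a b x y, rep a x → rep b y → rep (s a b) (x * y)
  deriv : ∀ i : Fin m, ∃ s : α → α, Computable s ∧ ∀ a x, rep a x → rep (s a) (δ i x)
  isZero : ∃ z : α → Bool, Computable z ∧ ∀ a x, rep a x → (z a = true ↔ x = 0)

namespace EffectiveNumbering

variable {m : ℕ}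

theorem zero {α R : Type*} [Primcodable α] [CommRing R] [DiffRing m R] {rep : α → R → Prop}
    (h : EffectiveNumbering m rep) : ∃ a, rep a 0 := by
  obtain ⟨a, ha⟩ := h.one
  obtain ⟨b, hb⟩ := h.negOne
  obtain ⟨s, -, hs⟩ := h.add
  exact ⟨s a b, by simpa using hs a b _ _ ha hb⟩

theorem of_isConstructive {k : Type*} [Field k] [DiffRing m k] {ν : ℕ → k}
    (hν : IsConstructive m ν) : EffectiveNumbering m fun a x => ν a = x where
  one := hν.surjective 1
  negOne := hν.surjective (-1)
  add := by
    obtain ⟨s, hs, h⟩ := hν.add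
    exact ⟨s, hs, by rintro a b _ _ rfl rfl; exact h a b⟩
  mul := by
    obtain ⟨s, hs, h⟩ := hν.mul
    exact ⟨s, hs, by rintro a b _ _ rfl rfl; exact h a b⟩
  deriv i := by
    obtain ⟨s, hs, h⟩ := hν.deriv i
    exact ⟨s, hs, by rintro a _ rfl; exact h a⟩
  isZero := by
    obtain ⟨f, hf, h⟩ := ComputablePred.computable_iff.1 hν.eq
    obtain ⟨z₀, hz₀⟩ := hν.surjective 0
    refine ⟨fun a => f (a, z₀), hf.comp (Computable.pair Computable.id (Computable.const z₀)), ?_⟩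
    rintro a _ rfl
    have := congrFun h (a, z₀)
    simp only [hz₀, eq_iff_iff] at this
    exact this.symm

theorem computable_shift {n : ℕ} (i : Fin m) :
    Computable fun v : Fin n × (Fin m → ℕ) => (v.1, v.2 + Pi.single i 1) := by
  have h : Primrec₂ fun (v : Fin n × (Fin m → ℕ)) (j : Fin m) =>
      v.2 j + (Pi.single i 1 : Fin m → ℕ) j :=
    Primrec.nat_add.comp (Primrec.fin_app.comp (Primrec.snd.comp Primrec.fst) Primrec.snd)
      ((Primrec.dom_finite (Pi.single i 1 : Fin m → ℕ)).comp Primrec.snd)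
  exact Computable.pair Computable.fst (Primrec.fin_curry.2 h).to_comp

theorem diffPoly {k : Type*} [Field k] [DiffRing m k] {ν : ℕ → k}
    (hν : EffectiveNumbering m fun a x => ν a = x) (n : ℕ) :
    EffectiveNumbering m fun (c : TermList (Fin n × (Fin m → ℕ))) (p : DiffPoly m n k) =>
      TermList.toPoly ν c = p where
  one := by
    obtain ⟨a, ha⟩ := hν.one
    exact ⟨[(a, [])], by simp [ha]⟩
  negOne := by
    obtain ⟨a, ha⟩ := hν.negOne
    exact ⟨[(a, [])], by simp [ha]⟩
  add := ⟨fun a b => a ++ b, Computable.append Computable.fst Computable.snd, by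
    rintro a b _ _ rfl rfl; exact TermList.toPoly_append a b⟩
  mul := by
    obtain ⟨s, hs, h⟩ := hν.mul
    refine ⟨TermList.mul s, TermList.computable_mul hs, ?_⟩
    rintro a b _ _ rfl rfl
    exact TermList.toPoly_mul (fun a b => h a b _ _ rfl rfl) a b
  deriv i := by
    obtain ⟨s, hs, h⟩ := hν.mul
    obtain ⟨d, hd, h'⟩ := hν.deriv i
    obtain ⟨one, hone⟩ := hν.one
    have hdv : Computable₂ fun (_ : Unit) (v : Fin n × (Fin m → ℕ)) =>
        ([(one, [(v.1, v.2 + Pi.single i 1)])] : TermList (Fin n × (Fin m → ℕ))) := by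
      have h1 := (computable_shift (n := n) i).comp
        (Computable.snd : Computable (Prod.snd : Unit × Fin n × (Fin m → ℕ) → _))
      have h2 := Computable.singleton (Computable.pair (Computable.const one)
        (Computable.singleton h1))
      exact h2
    have hc := (TermList.computable_deriv hs one hd hdv).comp
      (Computable.pair (Computable.const ()) Computable.id)
    refine ⟨_, hc, ?_⟩
    rintro a _ rfl
    exact TermList.toPoly_deriv (D := DiffPoly.derivation i) (DiffPoly.derivation_mul i)
      (fun a b => h a b _ _ rfl rfl) hone
      (fun a => by rw [DiffPoly.derivation_C, h' a _ rfl]) (fun v => by simp [hone]) a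
  isZero := by
    obtain ⟨s, hs, h⟩ := hν.add
    obtain ⟨z, hz, h'⟩ := hν.isZero
    obtain ⟨z₀, hz₀⟩ := hν.zero
    refine ⟨TermList.isZero s z₀ z, TermList.computable_isZero hs z₀ hz, ?_⟩
    rintro c _ rfl
    exact TermList.isZero_iff (fun a b => h a b _ _ rfl rfl) hz₀ (fun a => h' a _ rfl) c

section FractionRing

variable {α R : Type*} [Primcodable α] [CommRing R] [IsDomain R] [DiffRing m R]

/-- Pairs of codes denote fractions. -/
def FracRep (rep : α → R → Prop) (c : α × α) (x : FractionRing R) : Prop :=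
  ∃ a b, rep c.1 a ∧ rep c.2 b ∧ b ≠ 0 ∧
    x = algebraMap R (FractionRing R) a / algebraMap R (FractionRing R) b

omit [IsDomain R] [DiffRing m R] in
theorem algebraMap_fractionRing_ne_zero {b : R} (hb : b ≠ 0) :
    algebraMap R (FractionRing R) b ≠ 0 :=
  (map_ne_zero_iff _ (IsFractionRing.injective R (FractionRing R))).2 hb

/-- The quotient rule, with subtraction written through `-1 *` so that it uses only the operations
of an `EffectiveNumbering`. -/
theorem δ_div (i : Fin m) (a b : R) (hb : b ≠ 0) :
    δ i (algebraMap R (FractionRing R) a / algebraMap R (FractionRing R) b) =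
      algebraMap R (FractionRing R) (b * δ i a + -1 * (a * δ i b)) /
        algebraMap R (FractionRing R) (b * b) := by
  have hb' := algebraMap_fractionRing_ne_zero hb
  have hδ : ∀ r : R, δ i (algebraMap R (FractionRing R) r) =
      algebraMap R (FractionRing R) (δ i r) :=
    fracDerivation_algebraMap i
  have h := δ_mul i (algebraMap R (FractionRing R) a / algebraMap R (FractionRing R) b)
    (algebraMap R (FractionRing R) b)
  rw [div_mul_cancel₀ _ hb', hδ, hδ] at h
  rw [map_mul, eq_div_iff (mul_ne_zero hb' hb')]
  simp only [map_add, map_mul, map_neg, map_one]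
  rw [h]
  field_simp
  ring

theorem fractionRing {rep : α → R → Prop} (hR : EffectiveNumbering m rep) :
    EffectiveNumbering m (FracRep rep) := by
  obtain ⟨one, hone⟩ := hR.one
  obtain ⟨negOne, hnegOne⟩ := hR.negOne
  obtain ⟨add, hadd, add_spec⟩ := hR.add
  obtain ⟨mul, hmul, mul_spec⟩ := hR.mul
  obtain ⟨z, hz, z_spec⟩ := hR.isZero
  have hd₁ : Computable fun q : (α × α) × (α × α) => q.1.1 := Computable.fst.comp Computable.fst
  have hd₂ : Computable fun q : (α × α) × (α × α) => q.1.2 := Computable.snd.comp Computable.fst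
  have hd₃ : Computable fun q : (α × α) × (α × α) => q.2.1 := Computable.fst.comp Computable.snd
  have hd₄ : Computable fun q : (α × α) × (α × α) => q.2.2 := Computable.snd.comp Computable.snd
  refine ⟨⟨(one, one), 1, 1, hone, hone, one_ne_zero, by simp⟩,
    ⟨(negOne, one), -1, 1, hnegOne, hone, one_ne_zero, by simp⟩,
    ⟨fun c d => (add (mul c.1 d.2) (mul d.1 c.2), mul c.2 d.2), ?_, ?_⟩,
    ⟨fun c d => (mul c.1 d.1, mul c.2 d.2), ?_, ?_⟩, fun i => ?_,
    ⟨fun c => z c.1, hz.comp Computable.fst, ?_⟩⟩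
  · have h1 := hadd.comp (hmul.comp hd₁ hd₄) (hmul.comp hd₃ hd₂)
    exact Computable.pair h1 (hmul.comp hd₂ hd₄)
  · rintro c d _ _ ⟨a, b, ha, hb, hb0, rfl⟩ ⟨a', b', ha', hb', hb0', rfl⟩
    refine ⟨_, _, add_spec _ _ _ _ (mul_spec _ _ _ _ ha hb') (mul_spec _ _ _ _ ha' hb),
      mul_spec _ _ _ _ hb hb', mul_ne_zero hb0 hb0', ?_⟩
    rw [div_add_div _ _ (algebraMap_fractionRing_ne_zero hb0)
      (algebraMap_fractionRing_ne_zero hb0')]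
    simp only [map_add, map_mul]
    ring
  · exact Computable.pair (hmul.comp hd₁ hd₃) (hmul.comp hd₂ hd₄)
  · rintro c d _ _ ⟨a, b, ha, hb, hb0, rfl⟩ ⟨a', b', ha', hb', hb0', rfl⟩
    refine ⟨_, _, mul_spec _ _ _ _ ha ha', mul_spec _ _ _ _ hb hb', mul_ne_zero hb0 hb0', ?_⟩
    rw [div_mul_div_comm, map_mul, map_mul]
  · obtain ⟨d, hd, d_spec⟩ := hR.deriv i
    have h₁ : Computable fun c : α × α => c.1 := Computable.fst
    have h₂ : Computable fun c : α × α => c.2 := Computable.snd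
    refine ⟨fun c => (add (mul c.2 (d c.1)) (mul negOne (mul c.1 (d c.2))), mul c.2 c.2), ?_, ?_⟩
    · have h1 := hmul.comp h₂ (hd.comp h₁)
      have h2 := hmul.comp (Computable.const negOne) (hmul.comp h₁ (hd.comp h₂))
      exact Computable.pair (hadd.comp h1 h2) (hmul.comp h₂ h₂)
    · rintro c _ ⟨a, b, ha, hb, hb0, rfl⟩
      exact ⟨_, _, add_spec _ _ _ _ (mul_spec _ _ _ _ hb (d_spec _ _ ha))
        (mul_spec _ _ _ _ hnegOne (mul_spec _ _ _ _ ha (d_spec _ _ hb))),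
        mul_spec _ _ _ _ hb hb, mul_ne_zero hb0 hb0, δ_div i a b hb0⟩
  -- Testing the numerator is enough because `FracRep` demands a nonzero denominator.
  · rintro c _ ⟨a, b, ha, hb, hb0, rfl⟩
    rw [z_spec _ _ ha, div_eq_zero_iff,
      map_eq_zero_iff _ (IsFractionRing.injective R (FractionRing R))]
    simp [algebraMap_fractionRing_ne_zero hb0]

end FractionRing

/-! ### Computable verification of algebraic places. -/

section Check

variable {α R : Type*} [Primcodable α] [CommRing R] [DiffRing m R] {rep : α → R → Prop}

/-- The exponents in `θ` are input and are handled by computable iteration; the list of derivations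
is fixed, so the induction over it takes place outside the algorithm. -/
theorem exists_deriv (h : EffectiveNumbering m rep) : ∃ s : (Fin m → ℕ) → α → α, Computable₂ s ∧
    ∀ θ a x, rep a x → rep (s θ a) (DiffRing.deriv θ x) := by
  choose d hd d_spec using h.deriv
  refine ⟨fun θ a => (List.finRange m).foldr (fun i s => (d i)^[θ i] s) a, ?_, ?_⟩
  · have H : ∀ l : List (Fin m), Computable fun p : (Fin m → ℕ) × α =>
        l.foldr (fun i s => (d i)^[p.1 i] s) p.2 := by
      intro l
      induction l with
      | nil => exact Computable.snd
      | cons i l ih =>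
        have h1 : Computable fun p : (Fin m → ℕ) × α => p.1 i :=
          Computable.fin_app.comp Computable.fst (Computable.const i)
        have h2 := Computable.iterate h1 ih (hd i)
        exact h2
    exact H _
  · intro θ a x hx
    have H : ∀ l : List (Fin m), rep (l.foldr (fun i s => (d i)^[θ i] s) a)
        (l.foldr (fun i s => (δ i)^[θ i] s) x) := by
      intro l
      induction l with
      | nil => exact hx
      | cons i l ih =>
        rw [List.foldr_cons, List.foldr_cons]
        generalize θ i = N
        induction N with
        | zero => exact ih
        | succ N ihN =>
          rw [Function.iterate_succ_apply', Function.iterate_succ_apply']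
          exact d_spec i _ _ ihN
    exact H _

theorem computable_getD_deriv {α : Type*} [Primcodable α] {dc : (Fin m → ℕ) → α → α}
    (hdc : Computable₂ dc) (z₀ : α) :
    Computable₂ fun (E : List α) (v : ℕ × (Fin m → ℕ)) => dc v.2 (E.getD v.1 z₀) := by
  have h0 : Computable fun p : List α × ℕ × (Fin m → ℕ) => p.1 := Computable.fst
  have h1 : Computable fun p : List α × ℕ × (Fin m → ℕ) => p.2.2 :=
    Computable.snd.comp Computable.snd
  have h2 : Computable fun p : List α × ℕ × (Fin m → ℕ) => p.2.1 :=
    Computable.fst.comp Computable.snd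
  have h3 : Computable fun p : List α × ℕ => p.1.getD p.2 z₀ :=
    Primrec.to_comp (f := fun p : List α × ℕ => p.1.getD p.2 z₀) (Primrec.list_getD z₀)
  have h4 := h3.comp (Computable.pair h0 h2)
  have h5 := hdc.comp h1 h4
  exact h5

/-- The code of `1` if `v = w` and of `0` otherwise. -/
def kronecker (one : ℕ) (w v : ℕ × (Fin m → ℕ)) : TermList (ℕ × (Fin m → ℕ)) :=
  if v = w then [(one, [])] else []

theorem computable_kronecker (one : ℕ) :
    Computable₂ (kronecker one : ℕ × (Fin m → ℕ) → ℕ × (Fin m → ℕ) → _) := by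
  have h1 : Computable fun p : (ℕ × (Fin m → ℕ)) × (ℕ × (Fin m → ℕ)) => p.2 := Computable.snd
  have h2 : Computable fun p : (ℕ × (Fin m → ℕ)) × (ℕ × (Fin m → ℕ)) => p.1 := Computable.fst
  have h3 := Computable.cond (Computable.beq h1 h2)
    (Computable.const ([(one, [])] : TermList (ℕ × (Fin m → ℕ)))) (Computable.const [])
  refine h3.of_eq fun p => ?_
  by_cases h : p.2 = p.1
  · simp [kronecker, h]
  · rw [kronecker, if_neg h]
    exact congrArg (cond · _ _) (decide_eq_false h)

/-- Only variables `x_j^θ` with `j ≤ q` occur. -/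
def varsLE (q : ℕ) (g : TermList (ℕ × (Fin m → ℕ))) : Bool :=
  g.all fun t => t.2.all fun v => decide (v.1 ≤ q)

theorem computable_varsLE :
    Computable fun p : ℕ × TermList (ℕ × (Fin m → ℕ)) => varsLE p.1 p.2 := by
  have hle : Computable fun p : ℕ × ℕ => decide (p.1 ≤ p.2) :=
    Primrec.to_comp (Primrec.nat_le.decide)
  have h1 : Computable fun r : ((ℕ × TermList (ℕ × (Fin m → ℕ))) × ℕ × List (ℕ × (Fin m → ℕ))) ×
      ℕ × (Fin m → ℕ) => r.2.1 :=
    Computable.fst.comp Computable.snd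
  have h2 : Computable fun r : ((ℕ × TermList (ℕ × (Fin m → ℕ))) × ℕ × List (ℕ × (Fin m → ℕ))) ×
      ℕ × (Fin m → ℕ) => r.1.1.1 :=
    Computable.fst.comp (Computable.fst.comp Computable.fst)
  have h3 := hle.comp (Computable.pair h1 h2)
  have h4 : Computable fun r : (ℕ × TermList (ℕ × (Fin m → ℕ))) × ℕ × List (ℕ × (Fin m → ℕ)) =>
      r.2.2 := Computable.snd.comp Computable.snd
  have h5 := Computable.list_all
    (p := fun (r : (ℕ × TermList (ℕ × (Fin m → ℕ))) × ℕ × List (ℕ × (Fin m → ℕ)))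
      (v : ℕ × (Fin m → ℕ)) => decide (v.1 ≤ r.1.1)) h4 h3
  have h6 : Computable fun r : ℕ × TermList (ℕ × (Fin m → ℕ)) => r.2 := Computable.snd
  have h7 := Computable.list_all
    (p := fun (r : ℕ × TermList (ℕ × (Fin m → ℕ))) (t : ℕ × List (ℕ × (Fin m → ℕ))) =>
      t.2.all fun v => decide (v.1 ≤ r.1)) h6 h5
  exact h7

theorem exists_diffEval {k : Type*} [Field k] [DiffRing m k] {ν : ℕ → k} [Algebra k R]
    (hrep : EffectiveNumbering m rep) {cst : ℕ → α} (hcst : Computable cst)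
    (cst_spec : ∀ a, rep (cst a) (algebraMap k R (ν a))) {z₀ : α} (hz₀ : rep z₀ 0) :
    ∃ ev : List α → TermList (ℕ × (Fin m → ℕ)) → α,
      (Computable fun p : List α × TermList (ℕ × (Fin m → ℕ)) => ev p.1 p.2) ∧
      ∀ (E : List α) (e : ℕ → R), (∀ i, rep (E.getD i z₀) (e i)) → ∀ g,
        rep (ev E g) (diffEval k e (TermList.toPoly ν g)) := by
  obtain ⟨add, hadd, add_spec⟩ := hrep.add
  obtain ⟨mul, hmul, mul_spec⟩ := hrep.mul
  obtain ⟨dc, hdc, dc_spec⟩ := hrep.exists_deriv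
  exact ⟨_, TermList.computable_eval hadd hmul z₀ hcst (computable_getD_deriv hdc z₀),
    fun E e hE g => TermList.rep_eval add_spec mul_spec hz₀ cst_spec
      (fun v => dc_spec _ _ _ (hE _)) g⟩

/-- A partial derivative is the derivation that kills the coefficients and takes Kronecker values on
the variables, so `TermList.deriv` computes it. -/
theorem exists_pderiv {k : Type*} [Field k] [DiffRing m k] {ν : ℕ → k}
    (hν : EffectiveNumbering m fun a x => ν a = x) :
    ∃ pd : ℕ × (Fin m → ℕ) → TermList (ℕ × (Fin m → ℕ)) → TermList (ℕ × (Fin m → ℕ)),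
      (Computable fun p : (ℕ × (Fin m → ℕ)) × TermList (ℕ × (Fin m → ℕ)) => pd p.1 p.2) ∧
      ∀ w g, TermList.toPoly ν (pd w g) = pderiv w (TermList.toPoly ν g) := by
  obtain ⟨one, hone⟩ := hν.one
  obtain ⟨zeroK, hzeroK⟩ := hν.zero
  obtain ⟨s, hs, s_spec⟩ := hν.mul
  have hc : Computable fun p : (ℕ × (Fin m → ℕ)) × TermList (ℕ × (Fin m → ℕ)) =>
      TermList.deriv s one (fun _ => zeroK) (kronecker one p.1) p.2 :=
    TermList.computable_deriv hs one (Computable.const zeroK) (computable_kronecker one)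
  refine ⟨fun w g => TermList.deriv s one (fun _ => zeroK) (kronecker one w) g, hc, fun w g => ?_⟩
  refine TermList.toPoly_deriv (D := (pderiv w : Derivation k (MvPolynomial (ℕ × (Fin m → ℕ)) k)
    (MvPolynomial (ℕ × (Fin m → ℕ)) k)).toLinearMap.toAddMonoidHom)
    (fun p q => by
      change pderiv w (p * q) = p * pderiv w q + q * pderiv w p
      rw [Derivation.leibniz, smul_eq_mul, smul_eq_mul])
    (fun a b => s_spec a b _ _ rfl rfl) hone
    (fun a => by
      change C (ν zeroK) = pderiv w (C (ν a))
      rw [pderiv_C, hzeroK, C_0]) (fun v => ?_) g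
  classical
  change TermList.toPoly ν (kronecker one w v) = pderiv w (X v)
  rw [pderiv_X, Pi.single_apply, kronecker]
  by_cases hvw : v = w
  · subst hvw; simp [hone]
  · simp [hvw]

/-- The relation of being differentially algebraic over the preceding elements has computably
checkable witnesses. -/
theorem exists_check {k : Type*} [Field k] [DiffRing m k] {ν : ℕ → k}
    (hsurj : Function.Surjective ν) (hν : EffectiveNumbering m fun a x => ν a = x) [Algebra k R]
    (hrep : EffectiveNumbering m rep) {cst : ℕ → α} (hcst : Computable cst)
    (cst_spec : ∀ a, rep (cst a) (algebraMap k R (ν a))) {z₀ : α} (hz₀ : rep z₀ 0) :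
    ∃ chk : List α → ℕ → TermList (ℕ × (Fin m → ℕ)) × (Fin m → ℕ) → Bool,
      (Computable fun p : (List α × ℕ) × TermList (ℕ × (Fin m → ℕ)) × (Fin m → ℕ) =>
        chk p.1.1 p.1.2 p.2) ∧
      ∀ (E : List α) (e : ℕ → R), (∀ i, rep (E.getD i z₀) (e i)) → ∀ q,
        (DiffAlgOverPrev (m := m) k e q ↔ ∃ c, chk E q c = true) := by
  obtain ⟨s, -, s_spec⟩ := hν.mul
  obtain ⟨z, hz, z_spec⟩ := hrep.isZero
  obtain ⟨ev, hev, ev_spec⟩ := hrep.exists_diffEval hcst cst_spec hz₀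
  obtain ⟨pd, hpd, pd_spec⟩ := hν.exists_pderiv
  -- A witness is a coded relation with an exponent. Checked are: no variable beyond place `q`,
  -- value zero at `E`, separant nonzero at `E`.
  refine ⟨fun E q c => bif varsLE q c.1 then bif z (ev E c.1) then !z (ev E (pd (q, c.2) c.1))
    else false else false, ?_, ?_⟩
  · have p1 : Computable fun p : (List α × ℕ) × TermList (ℕ × (Fin m → ℕ)) × (Fin m → ℕ) =>
      p.1.1 := Computable.fst.comp Computable.fst
    have p2 : Computable fun p : (List α × ℕ) × TermList (ℕ × (Fin m → ℕ)) × (Fin m → ℕ) =>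
      p.1.2 := Computable.snd.comp Computable.fst
    have p3 : Computable fun p : (List α × ℕ) × TermList (ℕ × (Fin m → ℕ)) × (Fin m → ℕ) =>
      p.2.1 := Computable.fst.comp Computable.snd
    have p4 : Computable fun p : (List α × ℕ) × TermList (ℕ × (Fin m → ℕ)) × (Fin m → ℕ) =>
      p.2.2 := Computable.snd.comp Computable.snd
    have h1 := computable_varsLE.comp (Computable.pair p2 p3)
    have h2 := hz.comp (hev.comp (Computable.pair p1 p3))
    have h3 := hpd.comp (Computable.pair (Computable.pair p2 p4) p3)
    have h4 := hz.comp (hev.comp (Computable.pair p1 h3))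
    have h5 := Primrec.not.to_comp.comp h4
    have h6 := Computable.cond h1 (Computable.cond h2 h5 (Computable.const false))
      (Computable.const false)
    exact h6
  · intro E e hE q
    have hchk : ∀ g θ, (bif varsLE q g then bif z (ev E g) then !z (ev E (pd (q, θ) g))
        else false else false) = true ↔ (∀ t ∈ g, ∀ v ∈ t.2, v.1 ≤ q) ∧
          diffEval k e (TermList.toPoly ν g) = 0 ∧
          diffEval k e (pderiv (q, θ) (TermList.toPoly ν g)) ≠ 0 := by
      intro g θ
      rw [← z_spec _ _ (ev_spec E e hE g), ← pd_spec, Ne, ← z_spec _ _ (ev_spec E e hE _)]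
      have : varsLE q g = true ↔ ∀ t ∈ g, ∀ v ∈ t.2, v.1 ≤ q := by
        simp only [varsLE, List.all_eq_true, decide_eq_true_eq]
      rw [← this]
      cases varsLE q g <;> cases z (ev E g) <;> cases z (ev E (pd (q, θ) g)) <;> simp
    constructor
    · rintro ⟨g, hg, hg0, θ, hθ⟩
      obtain ⟨c, hc, rfl⟩ := TermList.exists_toPoly_eq hsurj (fun a b => s_spec a b _ _ rfl rfl) hg
      exact ⟨(c, θ), (hchk c θ).2 ⟨hc, hg0, hθ⟩⟩
    · rintro ⟨⟨c, θ⟩, h⟩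
      obtain ⟨hc, h0, hθ⟩ := (hchk c θ).1 h
      exact ⟨TermList.toPoly ν c, TermList.toPoly_mem_supported hc, h0, θ, hθ⟩

end Check

end EffectiveNumbering

/-! ### Codes of rational differential functions. -/

namespace RatCode

variable {m n : ℕ}

/-- The code of the fraction `0 / 1` if the denominator vanishes, and the code itself otherwise. -/
def normalize (z : PolyCode m n → Bool) (one : ℕ) (c : RatCode m n) : RatCode m n :=
  bif z c.2 then ([], [(one, [])]) else c

theorem computable_normalize {z : PolyCode m n → Bool} (hz : Computable z) (one : ℕ) :
    Computable (normalize z one) := by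
  have h1 : Computable fun c : RatCode m n => z c.2 := hz.comp Computable.snd
  have h2 := Computable.cond h1 (Computable.const (([], [(one, [])]) : RatCode m n)) Computable.id
  exact h2

/-- The code of the constant with number `a`. -/
def const (one a : ℕ) : RatCode m n := ([(a, [])], [(one, [])])

theorem computable_const (one : ℕ) : Computable (const one : ℕ → RatCode m n) := by
  have h1 : Computable fun a : ℕ => (a, ([] : List (Fin n × (Fin m → ℕ)))) :=
    Computable.pair Computable.id (Computable.const [])
  have h2 := Computable.pair (Computable.singleton h1)
    (Computable.const ([(one, [])] : PolyCode m n))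
  exact h2

/-- The code of the variable `x_j`. -/
def var (one : ℕ) (j : Fin n) : RatCode m n := ([(one, [(j, 0)])], [(one, [])])

theorem computable_var (one : ℕ) : Computable (var one : Fin n → RatCode m n) :=
  (Primrec.dom_finite _).to_comp

variable {k : Type*} [Field k] {ν : ℕ → k}

/-- A code with nonvanishing denominator denotes the quotient. -/
abbrev Denotes (ν : ℕ → k) (c : RatCode m n) (x : DiffRat m n k) : Prop :=
  EffectiveNumbering.FracRep
    (fun (c : PolyCode m n) (p : DiffPoly m n k) => TermList.toPoly ν c = p) c x

theorem denotes_normalize {z : PolyCode m n → Bool}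
    (hz : ∀ c, z c = true ↔ PolyCode.value ν c = 0) {one : ℕ} (hone : ν one = 1)
    (c : RatCode m n) : Denotes ν (normalize z one c) (value ν c) := by
  cases h : z c.2
  · rw [normalize, h]
    refine ⟨_, _, rfl, rfl, fun h0 => ?_, rfl⟩
    have := (hz c.2).2 h0
    simp [h] at this
  · rw [normalize, h]
    refine ⟨0, 1, rfl, by simp [hone], one_ne_zero, ?_⟩
    rw [value, (hz c.2).1 h]
    simp

theorem denotes_const {one : ℕ} (hone : ν one = 1) (a : ℕ) :
    Denotes ν (const one a : RatCode m n) (algebraMap k (DiffRat m n k) (ν a)) := by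
  refine ⟨C (ν a), 1, by simp [const], by simp [const, hone], one_ne_zero, ?_⟩
  rw [map_one, div_one, IsScalarTower.algebraMap_apply k (DiffPoly m n k) (DiffRat m n k)]
  rfl

theorem denotes_var {one : ℕ} (hone : ν one = 1) (j : Fin n) :
    Denotes ν (var one j : RatCode m n) (ratVar (j, 0)) := by
  refine ⟨X (j, 0), 1, by simp [var, hone], by simp [var, hone], one_ne_zero, ?_⟩
  rw [map_one, div_one]
  rfl

end RatCode

/-! ### Enumerability of dependence and of independence. -/

theorem List.Forall₂.getD {α β : Type*} {r : α → β → Prop} {l : List α} {l' : List β}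
    (h : List.Forall₂ r l l') {a : α} {b : β} (hab : r a b) (i : ℕ) :
    r (l.getD i a) (l'.getD i b) := by
  induction h generalizing i with
  | nil => exact hab
  | cons hr _ ih => cases i with
    | zero => exact hr
    | succ i => exact ih i

theorem rePred_exists_check {α γ : Type*} [Primcodable α] [Primcodable γ]
    {chk : List α → ℕ → γ → Bool}
    (hchk : Computable fun p : (List α × ℕ) × γ => chk p.1.1 p.1.2 p.2)
    {f : α → α} (hf : Computable f) :
    REPred fun l : List α => ∃ c : ℕ × γ,
      (bif decide (c.1 < l.length) then chk (l.map f) c.1 c.2 else false) = true := by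
  have hlt : Computable fun p : ℕ × ℕ => decide (p.1 < p.2) :=
    Primrec.to_comp (Primrec.nat_lt.decide)
  have h1 : Computable fun p : List α × ℕ × γ => p.1 := Computable.fst
  have h2 : Computable fun p : List α × ℕ × γ => p.2.1 := Computable.fst.comp Computable.snd
  have h3 : Computable fun p : List α × ℕ × γ => p.2.2 := Computable.snd.comp Computable.snd
  have h4 : Computable fun l : List α => l.length := Computable.list_length
  have h5 := hlt.comp (Computable.pair h2 (h4.comp h1))
  have h6 : Computable fun q : (List α × ℕ × γ) × α => f q.2 := hf.comp Computable.snd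
  have h7 := Computable.list_map (g := fun (_ : List α × ℕ × γ) (a : α) => f a) h1 h6
  have h8 := hchk.comp (Computable.pair (Computable.pair h7 h2) h3)
  have h9 := Computable.cond h5 h8 (Computable.const false)
  exact REPred.exists_of_computable (c := fun (l : List α) (c : ℕ × γ) =>
    bif decide (c.1 < l.length) then chk (l.map f) c.1 c.2 else false) h9

/-- The witnesses for all `n` variables are guessed at once as a function on `Fin n`, which has a
finite code; the quantifier over `j` then becomes a finite test. -/
theorem rePred_exists_forall_check {n : ℕ} {α γ : Type*} [Primcodable α] [Primcodable γ]
    {chk : List α → ℕ → γ → Bool}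
    (hchk : Computable fun p : (List α × ℕ) × γ => chk p.1.1 p.1.2 p.2)
    {f : α → α} (hf : Computable f) {x : Fin n → α} (hx : Computable x) (l₀ : List α) :
    REPred fun l : List α => ∃ c : List (Fin n) × (Fin n → γ),
      (bif decide (l.length + c.1.length ≤ n) then
        (List.finRange n).all fun j => chk (l.map f ++ c.1.map x ++ l₀)
          (l.length + c.1.length + j) (c.2 j)
      else false) = true := by
  have hle : Computable fun p : ℕ => decide (p ≤ n) :=
    Primrec.to_comp (Primrec.nat_le.decide.comp Primrec.id (Primrec.const n))
  have hadd : Computable fun p : ℕ × ℕ => p.1 + p.2 := Primrec.to_comp Primrec.nat_add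
  have hval : Computable fun j : Fin n => (j : ℕ) := Primrec.to_comp Primrec.fin_val
  have happ : Computable fun p : (Fin n → γ) × Fin n => p.1 p.2 := Computable.fin_app
  have h1 : Computable fun p : List α × List (Fin n) × (Fin n → γ) => p.1 := Computable.fst
  have h2 : Computable fun p : List α × List (Fin n) × (Fin n → γ) => p.2.1 :=
    Computable.fst.comp Computable.snd
  have h3 : Computable fun p : List α × List (Fin n) × (Fin n → γ) => p.2.2 :=
    Computable.snd.comp Computable.snd
  have h4 : Computable fun l : List α => l.length := Computable.list_length
  have h4' : Computable fun l : List (Fin n) => l.length := Computable.list_length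
  have h5 := hadd.comp (Computable.pair (h4.comp h1) (h4'.comp h2))
  have h6 : Computable fun q : (List α × List (Fin n) × (Fin n → γ)) × α => f q.2 :=
    hf.comp Computable.snd
  have h7 := Computable.list_map
    (g := fun (_ : List α × List (Fin n) × (Fin n → γ)) (a : α) => f a) h1 h6
  have h8 : Computable fun q : (List α × List (Fin n) × (Fin n → γ)) × Fin n => x q.2 :=
    hx.comp Computable.snd
  have h9 := Computable.list_map
    (g := fun (_ : List α × List (Fin n) × (Fin n → γ)) (j : Fin n) => x j) h2 h8
  have h10 := Computable.append (Computable.append h7 h9) (Computable.const l₀)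
  have q1 : Computable fun q : (List α × List (Fin n) × (Fin n → γ)) × Fin n => q.1 :=
    Computable.fst
  have q2 : Computable fun q : (List α × List (Fin n) × (Fin n → γ)) × Fin n => q.2 :=
    Computable.snd
  have h11 := hadd.comp (Computable.pair (h5.comp q1) (hval.comp q2))
  have h12 := happ.comp (Computable.pair (h3.comp q1) q2)
  have h13 := hchk.comp (Computable.pair (Computable.pair (h10.comp q1) h11) h12)
  have h14 := Computable.list_all
    (p := fun (p : List α × List (Fin n) × (Fin n → γ)) (j : Fin n) =>
      chk (p.1.map f ++ p.2.1.map x ++ l₀) (p.1.length + p.2.1.length + j) (p.2.2 j))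
    (Computable.const (List.finRange n)) h13
  have h15 := Computable.cond (hle.comp h5) h14 (Computable.const false)
  exact REPred.exists_of_computable (c := fun (l : List α) (c : List (Fin n) × (Fin n → γ)) =>
    bif decide (l.length + c.1.length ≤ n) then
      (List.finRange n).all fun j => chk (l.map f ++ c.1.map x ++ l₀)
        (l.length + c.1.length + j) (c.2 j)
    else false) h15

theorem theorem2 {k : Type*} [Field k] [CharZero k] {m : ℕ} [DiffRing m k] (ν : ℕ → k)
    (hν : IsConstructive m ν) (n : ℕ) :
    ComputablePred fun L : List (RatCode m n) =>
      DiffAlgDependent m k (B := DiffRat m n k)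
        (fun i : Fin L.length => RatCode.value ν (L.get i)) := by
  have hE := EffectiveNumbering.of_isConstructive hν
  have hP := hE.diffPoly n
  obtain ⟨one, hone⟩ := hE.one
  obtain ⟨z, hz, z_spec⟩ := hP.isZero
  have hF := hP.fractionRing
  -- The code of zero is the default beyond the end of a list of codes, matching the default `0` of
  -- the sequence of elements.
  obtain ⟨z₀, hz₀⟩ := hF.zero
  obtain ⟨chk, hchk, chk_spec⟩ := EffectiveNumbering.exists_check hν.surjective hE hF
    (RatCode.computable_const one) (RatCode.denotes_const hone) hz₀
  have norm_spec : ∀ L : List (RatCode m n), List.Forall₂ (RatCode.Denotes ν)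
      (L.map (RatCode.normalize z one)) (L.map (RatCode.value ν)) := fun L =>
    List.forall₂_map_left_iff.2 (List.forall₂_map_right_iff.2 (List.forall₂_same.2
      fun c _ => RatCode.denotes_normalize (fun c => z_spec c _ rfl) hone c))
  have var_spec : ∀ J : List (Fin n), List.Forall₂ (RatCode.Denotes ν)
      (J.map (RatCode.var one)) (J.map fun j => (ratVar (j, 0) : DiffRat m n k)) := fun J =>
    List.forall₂_map_left_iff.2 (List.forall₂_map_right_iff.2 (List.forall₂_same.2
      fun j _ => RatCode.denotes_var hone j))
  have hdep : ∀ L : List (RatCode m n), DiffAlgDependent m k (B := DiffRat m n k)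
      (fun i : Fin L.length => RatCode.value ν (L.get i)) ↔
      ∃ q < (L.map (RatCode.value ν)).length,
        DiffAlgOverPrev (m := m) k (fun j => (L.map (RatCode.value ν)).getD j 0) q := fun L => by
    rw [List.length_map]
    exact diffAlgDependent_iff _ _ fun i => by simp
  -- Post's theorem. Codes are normalized before checking, since the zero test is valid only for
  -- nonvanishing denominators.
  refine ComputablePred.computable_iff_re_compl_re'.2 ⟨?_, ?_⟩
  · refine (rePred_exists_check hchk
      (RatCode.computable_normalize hz one)).of_eq fun L => ?_
    rw [hdep, List.length_map]
    have h := chk_spec _ _ ((norm_spec L).getD hz₀)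
    simp only [h]
    constructor
    · rintro ⟨⟨q, c⟩, hc⟩
      by_cases hq : q < L.length
      · exact ⟨q, hq, c, by simpa [hq] using hc⟩
      · simp [hq] at hc
    · rintro ⟨q, hq, c, hc⟩
      exact ⟨⟨q, c⟩, by simpa [hq] using hc⟩
  · refine (rePred_exists_forall_check hchk
      (RatCode.computable_normalize hz one) (RatCode.computable_var one)
      ((List.finRange n).map (RatCode.var one))).of_eq fun L => ?_
    rw [hdep, not_diffAlgDependent_iff, List.length_map]
    have h := fun J : List (Fin n) => chk_spec _ _ ((List.rel_append
      (List.rel_append (norm_spec L) (var_spec J)) (var_spec (List.finRange n))).getD hz₀)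
    simp only [ratVars, h]
    constructor
    · rintro ⟨⟨J, c⟩, hc⟩
      by_cases hJ : L.length + J.length ≤ n
      · refine ⟨J, hJ, fun j => ⟨c j, ?_⟩⟩
        simp only [hJ, decide_true, cond_true, List.all_eq_true] at hc
        exact hc j (List.mem_finRange j)
      · simp [hJ] at hc
    · rintro ⟨J, hJ, hc⟩
      choose c hc using hc
      refine ⟨⟨J, c⟩, ?_⟩
      simp only [hJ, decide_true, cond_true, List.all_eq_true]
      exact fun j _ => hc j
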